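/- **Setting (unrefined limit).** Let $N\ge 3$, let $q_1=e^{\tau}\in\mathbb C^*$ not be a root of unity, $v=e^{\ell}$, $u\in\mathbb C^*$, $M\in\mathbb Z$, and let $\lambda$ be a Young diagram. The deformation parameters of the quantum toroidal algebra of $\mathfrak{gl}_N$ are $\mathfrak q=1$, $\mathfrak d=q_1$ (so $q_3=q_1^{-1}$). Colours are elements of $\mathbb Z/N$, also represented by $0,\dots,N-1$; $a_{ij}=2\bar\delta_{i,j}-\bar\delta_{i-1,j}-\bar\delta_{i+1,j}$, $m_{ij}=\bar\delta_{i-1,j}-\bar\delta_{i+1,j}$. *Fock space.* The horizontal Fock space is the tensor product of the Fock space of the bosons $[H_{i,r},H_{j,s}]=\delta_{r+s,0}\,r\,a_{ij}q_1^{-rm_{ij}}$ ($r,s\neq0$) with the twisted group algebra of the lattice generated by weights $\tilde\alpha_0,\dots,\tilde\alpha_{N-1}$, $\sum_d\tilde\alpha_d=0$ ($\tilde\alpha_d=\varepsilon_d-\frac1N\sum_f\varepsilon_f$). With $\alpha_c=\tilde\alpha_c-\tilde\alpha_{c-1}$ one has $e^{\alpha_i}e^{\alpha_j}=(-1)^{a_{ij}}e^{\alpha_j}e^{\alpha_i}$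 and $z^{H_{i,0}}e^{\alpha_j}=z^{a_{ij}}q_1^{-m_{ij}/2}e^{\alpha_j}z^{H_{i,0}}$; on momentum $x=\sum_d x_d\varepsilon_d$, $z^{H_{c,0}}=z^{x_c-x_{c-1}}q_1^{-(x_c+x_{c-1})/2}$. The operators $z^{\tilde H_{d,0}}$ are $z^{x_d}q_1^{y_d(x)}$ with $y_d(x)=-\frac12x_d-\sum_{f<d}x_f-\frac1N\sum_f f\,x_f$. Since $z^{H}$ contains a factor independent of $z$, for a monomial $A=q_1^kv^b$ the symbol $A^{\tilde H_{d,0}}$ means $q_1^{kx_d}\,(v^{\tilde H_{d,0}})^b$, that is, it is multiplicative in factors of degree one in $v$. *Intertwiner.* Let $\eta_c(z)=\,:\!\exp\big(\sum_{r\ge1}\frac1r(z^rH_{c,-r}-z^{-r}H_{c,r})\big)\!:$ and $$\Phi_\lambda(v)=\frac{t_\lambda}{C_\lambda}\,u^{|\lambda|_0}(-v)^{-M|\lambda|_0}f_\lambda^{-M-1}\,z_\lambda(v)\;:\prod_{(i,j)\in\lambda}\eta_{i-j}(q_1^{j-i}v)\,\Phi_\varnothing(v):,\qquad \Phi_\varnothing(v)=\,:\prod_{i,j\ge1}\eta_{i-j}(q_1^{j-i}v)^{-1}:,$$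 the $\lambda$-component of the intertwiner $\mathcal F_v^{(0,1)}\otimes\mathcal F_u^{(1,M)}\to\mathcal F^{(1,M+1)}_{-uv}$ at $\mathfrak q=1$. The infinite product is understood by resummation of geometric series in $q_1,q_3$ followed by $q_3\to q_1^{-1}$, so that $\Phi_\varnothing(v)=:\!\exp\big(-\sum_{r\ge1}\frac1r\sum_c[B_c(q_1^r)v^rH_{c,-r}-(r\leftrightarrow-r)]\big)\!:$ with $B_c(x)=\frac{(N-c)x^{-c}+c\,x^{N-c}}{(1-x^N)(1-x^{-N})}$. Here $z_\lambda(v)$ is the product of the zero modes $e^{\alpha_{i-j}}(q_1^{j-i}v)^{H_{i-j,0}+1}$ over the boxes, where a box stands to the right of all later boxes in row-by-row reading order; $C_\lambda=\prod_{N\mid h(\square)}(1-q_1^{h(\square)})$ over hook lengths $h$, $t_\lambda=\prod_{(i,j)\in\lambda,\,N\mid j}(-q_1^j)$, $f_\lambda=\prod_{(i,j)\in\lambda,\,N\mid i-j}(-q_1^{j-i})$, and $|\lambda|_0$ is the number of boxes with $N\mid i-j$. *Quotients.* Let $S(\lambda)=\{\lambda'_j-j: j\ge1\}\subset\mathbb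 Z$ be the Maya diagram ($\lambda'$ the transpose), let $p_d=\#\{m<0:m\notin S(\lambda),m\equiv d\}-\#\{m\ge0:m\in S(\lambda),m\equiv d\}$ (mod $N$), and let $\lambda^{(d)}$ be the diagram with $S(\lambda^{(d)})=\{m: N(m-p_d)+d\in S(\lambda)\}$. *Abelian intertwiner.* For a boson with $[H_r,H_s]=(1-Q^r)(1-Q^{-r})\,r\,\delta_{r+s,0}$, up to a scalar, $$\Psi^{(Q)}_\mu(z,H)=\,:\exp\sum_{r\ge1}\frac1r\Big[\Big(\mathrm{ch}_\mu(Q^r)-\frac{1}{(1-Q^{-r})(1-Q^r)}\Big)z^rH_{-r}-(r\leftrightarrow-r)\Big]:,\qquad \mathrm{ch}_\mu(Q)=\sum_{(i,j)\in\mu}Q^{j-i}.$$ **Statement.** Put $\tilde H_{d,r}=\sum_{c=0}^{N-1}L_{cd}(q_1^{-r})H_{c,r}$, $L_{cd}(x)=x^{-N\lfloor (d-c)/N\rfloor-c+d}$. Then: 1. $[\tilde H_{d,r},\tilde H_{f,s}]=(1-q_1^{rN})(1-q_1^{-rN})\,r\,\delta_{df}\delta_{r+s,0}$, that is, the $\tilde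 H_{d,\cdot}$ are $N$ independent bosons of parameter $q_1^N$; and $z^{H_{c,0}}z^{\tilde H_{c-1,0}}=z^{\tilde H_{c,0}}$, $\prod_dz^{\tilde H_{d,0}}=1$. 2. The quotients $\lambda^{(d)}$ exist, $\sum_dp_d=0$, and the operators $\Psi^{(q_1^N)}_{\lambda^{(d)}}(q_1^{Np_d-d}v,\tilde H_{d,\cdot})$, $d=0,\dots,N-1$, are well defined and commute with each other (all homogeneous components commute). 3. There is a nonzero scalar $s$ such that $$\Phi_\lambda(v)=s\prod_{d=0}^{N-1}e^{-p_d\tilde\alpha_d}\Big(q_1^{-N|\lambda^{(d)}|-\frac12Np_d(p_d+1)+dp_d+\sum_{f=0}^{N-1}\lfloor\frac{d-f}N\rfloor p_f}\,v^{-p_d}\Big)^{\tilde H_{d,0}}\,\Psi^{(q_1^N)}_{\lambda^{(d)}}\big(q_1^{Np_d-d}v,\tilde H_{d,\cdot}\big).$$ Vertex operators map the Fock space to its completion and are given by their homogeneous components; the product on the right means that in each degree, on each vector, only finitely many products of components contribute, and the equality holds degree by degree. -/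

import Mathlib

/-!
The horizontal Fock space of the quantum toroidal algebra of `gl_N`, its vertex operators and the
components `Φ_λ(v)` of the intertwiner, for general deformation parameters
`𝔮 = exp ε`, `𝔡 = exp τ` (so `q₁ = 𝔡 𝔮⁻¹ = exp (τ - ε)`, `q₃ = 𝔡⁻¹ 𝔮⁻¹ = exp (-τ - ε)`).
Arguments of currents are given by their logarithms: `z = exp y`, `v = exp ℓ`.
Rows and columns of Young diagrams are numbered from 0, colours are elements of `ZMod N`.
-/

noncomputable section

namespace Toroidal

open Complex

/-! ### Numerical data -/

/-- The symmetric quantum integer `[n] = (𝔮ⁿ - 𝔮⁻ⁿ) / (𝔮 - 𝔮⁻¹)` with `𝔮 = exp ε`, written as the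
Laurent polynomial `± (𝔮^(|n|-1) + 𝔮^(|n|-3) + ⋯ + 𝔮^(1-|n|))`, so that it makes sense at `𝔮 = 1`. -/
def qInt (ε : ℂ) (n : ℤ) : ℂ :=
  (n.sign : ℂ) * ∑ k ∈ Finset.range n.natAbs, exp (((n.natAbs : ℂ) - 1 - 2 * (k : ℂ)) * ε)

/-- Kronecker symbol modulo `N`. -/
def kron {N : ℕ} (i j : ZMod N) : ℤ := if i = j then 1 else 0

/-- The Cartan matrix `a_{ij}` of type `A_{N-1}^{(1)}`. -/
def cartan {N : ℕ} (i j : ZMod N) : ℤ := 2 * kron i j - (kron (i - 1) j + kron (i + 1) j)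

/-- The skew-symmetric matrix `m_{ij}`. -/
def skew {N : ℕ} (i j : ZMod N) : ℤ := kron (i - 1) j - kron (i + 1) j

/-- The deformed Cartan matrix `C^{[r]}_{ij} = ([r a_{ij}] / [r]) 𝔡^{-r m_{ij}}`, `r ≠ 0`. -/
def deformedCartan (N : ℕ) (ε τ : ℂ) (r : ℤ) : Matrix (ZMod N) (ZMod N) ℂ :=
  Matrix.of fun i j => qInt ε (r * cartan i j) / qInt ε r * exp (-((r * skew i j : ℤ) : ℂ) * τ)

/-! ### The weight lattice and the Fock space -/

/-- `α̃_d = ε_d - (1/N) (1, …, 1)`, so that `∑_d α̃_d = 0`. -/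
def tildeAlphaVec (N : ℕ) (d : ZMod N) : ZMod N → ℚ := fun f => (if f = d then 1 else 0) - 1 / (N : ℚ)

/-- The lattice generated by the `α̃_d` (the weight lattice of `sl_N`).  It contains the root lattice,
generated by the `α_c = α̃_c - α̃_{c-1}`. -/
def weightLattice (N : ℕ) : AddSubgroup (ZMod N → ℚ) :=
  AddSubgroup.closure (Set.range (tildeAlphaVec N))

/-- `α̃_d` as an element of the lattice. -/
def tildeAlpha (N : ℕ) (d : ZMod N) : weightLattice N :=
  ⟨tildeAlphaVec N d, AddSubgroup.subset_closure ⟨d, rfl⟩⟩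

/-- `α_c = ∑_d (δ_{c,d} - δ_{(c-d) mod N, 1}) α̃_d = α̃_c - α̃_{c-1}`. -/
def simpleRoot (N : ℕ) (c : ZMod N) : weightLattice N := tildeAlpha N c - tildeAlpha N (c - 1)

/-- The oscillator Fock space: the variable `(c, k)` is the creation operator `H_{c,-(k+1)}`. -/
abbrev Osc (N : ℕ) : Type := MvPolynomial (ZMod N × ℕ) ℂ

/-- The horizontal Fock space: (group algebra of the lattice) `⊗` (oscillator Fock space). -/
abbrev Fock (N : ℕ) : Type := weightLattice N →₀ Osc N

/-- The Heisenberg generators at central charge one on the oscillator Fock space,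
`[H_{i,r}, H_{j,s}] = δ_{r+s,0} ([r]² / r) C^{[r]}_{ij}`; there is no mode `0` here. -/
def oscBoson (N : ℕ) [NeZero N] (ε τ : ℂ) (c : ZMod N) : ℤ → Module.End ℂ (Osc N)
  | .negSucc k => LinearMap.mulLeft ℂ (MvPolynomial.X (c, k))
  | .ofNat 0 => 0
  | .ofNat (k + 1) => ∑ e : ZMod N,
      (qInt ε (k + 1) ^ 2 / ((k : ℂ) + 1) * deformedCartan N ε τ (k + 1) c e) •
        (MvPolynomial.pderiv (e, k)).toLinearMap

/-- The Heisenberg generators `H_{c,m}`, `m ≠ 0`, on the horizontal Fock space. -/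
def boson (N : ℕ) [NeZero N] (ε τ : ℂ) (c : ZMod N) (m : ℤ) : Module.End ℂ (Fock N) :=
  Finsupp.mapRange.linearMap (oscBoson N ε τ c m)

/-! ### Zero modes -/

/-- Bimultiplicative two-cocycle `∏_{g < f} (-1)^{β_f x_g}`; on the root lattice its values are `±1`. -/
def cocycle {N : ℕ} [NeZero N] (β x : weightLattice N) : ℂ :=
  exp (Real.pi * I * ((∑ f : ZMod N, ∑ g : ZMod N,
    if g.val < f.val then β.1 f * x.1 g else 0 : ℚ) : ℂ))

/-- The operator `e^β`: it shifts the momentum `x` by `β`, with the twist given by the cocycle.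
One has `e^{α_i} e^{α_j} = (-1)^{a_{ij}} e^{α_j} e^{α_i}`. -/
def expOp {N : ℕ} [NeZero N] (β : weightLattice N) : Module.End ℂ (Fock N) :=
  Finsupp.lsum ℂ fun x => cocycle β x • Finsupp.lsingle (x + β)

/-- An operator that acts on the sector of momentum `x` as the scalar `φ x`. -/
def diagOp {N : ℕ} (φ : weightLattice N → ℂ) : Module.End ℂ (Fock N) :=
  Finsupp.lsum ℂ fun x => φ x • Finsupp.lsingle x

/-- `z^{H_{c,0}}` with `z = exp y`.  One has
`z^{H_{i,0}} e^{α_j} = z^{a_{ij}} 𝔡^{-m_{ij}/2} e^{α_j} z^{H_{i,0}}`. -/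
def powH {N : ℕ} (τ : ℂ) (c : ZMod N) (y : ℂ) : Module.End ℂ (Fock N) :=
  diagOp fun x => exp (y * ((x.1 c - x.1 (c - 1) : ℚ) : ℂ) - τ / 2 * ((x.1 c + x.1 (c - 1) : ℚ) : ℂ))

/-- Exponent of the `z`-independent factor (a power of `𝔡`) in `z^{H̃_{d,0}}`. -/
def tildeShift {N : ℕ} [NeZero N] (d : ZMod N) (x : weightLattice N) : ℚ :=
  -(x.1 d) / 2 - (∑ f : ZMod N, if f.val < d.val then x.1 f else 0)
    - (1 / (N : ℚ)) * ∑ f : ZMod N, (f.val : ℚ) * x.1 f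

/-- `z₁^{H̃_{d,0}} ⋯ z_b^{H̃_{d,0}}` for `z₁ ⋯ z_b = exp y`; for `b < 0` the inverse of such a product.
(As `z^{H_{c,0}}` contains a `z`-independent power of `𝔡`, such a product depends on the product of
the `z`'s and on their number.)  The power `z^{H̃_{d,0}}` itself is the case `b = 1`. -/
def powHTilde {N : ℕ} [NeZero N] (τ : ℂ) (d : ZMod N) (y : ℂ) (b : ℤ) : Module.End ℂ (Fock N) :=
  diagOp fun x => exp (y * ((x.1 d : ℚ) : ℂ) + (b : ℂ) * τ * ((tildeShift d x : ℚ) : ℂ))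

/-! ### Normal ordered exponentials -/

section NormalOrdering

variable {V : Type*} [AddCommGroup V] [Module ℂ V]

/-- Coefficient of `t^k` in `exp g`, for a power series `g` in `t` without constant term. -/
def expCoeff (g : PowerSeries (Module.End ℂ V)) (k : ℕ) : Module.End ℂ V :=
  ∑ j ∈ Finset.range (k + 1), ((j.factorial : ℂ)⁻¹) • PowerSeries.coeff k (g ^ j)

/-- `∑_{r ≥ 1} X_{-r} t^r`. -/
def creationSeries (X : ℤ → Module.End ℂ V) : PowerSeries (Module.End ℂ V) :=
  PowerSeries.mk fun r => if r = 0 then 0 else X (-(r : ℤ))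

/-- `∑_{r ≥ 1} X_r t^r`. -/
def annihilationSeries (X : ℤ → Module.End ℂ V) : PowerSeries (Module.End ℂ V) :=
  PowerSeries.mk fun r => if r = 0 then 0 else X (r : ℤ)

/-- Every vector is killed by almost all homogeneous parts of `exp (∑_{r ≥ 1} X_r)`. -/
def NormalOrderable (X : ℤ → Module.End ℂ V) : Prop :=
  ∀ f : V, {l : ℕ | expCoeff (annihilationSeries X) l f ≠ 0}.Finite

/-- The normal ordered exponential
`: exp (∑_{m ≠ 0} X_m) : = exp (∑_{r ≥ 1} X_{-r}) exp (∑_{r ≥ 1} X_r)`.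
It maps the Fock space to a completion, so it is given by its homogeneous parts: `normalExp X n` is
the part that raises the degree by `n`, where `X_m` has degree `-m`.  On each vector
the sum is finite if `X` is `NormalOrderable`. -/
def normalExp (X : ℤ → Module.End ℂ V) (n : ℤ) : Function.End V := fun f =>
  ∑ᶠ l : ℕ, if 0 ≤ n + (l : ℤ) then
    expCoeff (creationSeries X) (n + (l : ℤ)).toNat (expCoeff (annihilationSeries X) l f) else 0

end NormalOrdering

/-! ### The intertwiner of the toroidal algebra of `gl_N` -/

/-- `η_c(z) = V_c^{(-)}(𝔮^{-1/2} z) V_c^{(+)}(𝔮^{1/2} z)`, `z = exp y`, where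
`V_c^{(±)}(z) = exp (∓ ∑_{r ≥ 1} H_{c,±r} z^{∓r} / [r])`: the term of its exponent with `H_{c,m}`. -/
def etaExponent (N : ℕ) [NeZero N] (ε τ : ℂ) (c : ZMod N) (y : ℂ) (m : ℤ) :
    Module.End ℂ (Fock N) :=
  (-(qInt ε m)⁻¹ * exp (-(m : ℂ) * (y + if 0 < m then ε / 2 else -ε / 2))) • boson N ε τ c m

/-- The dual generators `Λ_{0,m} = ∑_c ((C^{[m]})⁻¹)_{0c} H_{c,m} / [m]`, normalized by
`[Λ_{0,r}, H_{j,s}] = δ_{r+s,0} δ_{0j} [r] / r`. -/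
def dualBoson (N : ℕ) [NeZero N] (ε τ : ℂ) (m : ℤ) : Module.End ℂ (Fock N) :=
  ∑ c : ZMod N, ((deformedCartan N ε τ m)⁻¹ 0 c * (qInt ε m)⁻¹) • boson N ε τ c m

/-- The vacuum component `Φ_∅(v) = : ∏_{i,j ≥ 1} η_{i-j}(q₁^{j-1} q₃^{i-1} v)⁻¹ :`, `v = exp ℓ`.
The infinite product is resummed by geometric series, which gives
`Ṽ^{(-)}(𝔮^{1/2} v) Ṽ^{(+)}(𝔮^{3/2} v)⁻¹` with `Ṽ^{(±)}(z) = exp (∓ ∑_{r ≥ 1} Λ_{0,±r} z^{∓r})`. -/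
def vacuumExponent (N : ℕ) [NeZero N] (ε τ ℓ : ℂ) (m : ℤ) : Module.End ℂ (Fock N) :=
  exp (-(m : ℂ) * (ℓ + if 0 < m then 3 * ε / 2 else ε / 2)) • dualBoson N ε τ m

/-- Colour `i - j mod N` of the box `b = (i, j)`. -/
def color (N : ℕ) (b : ℕ × ℕ) : ZMod N := (b.1 : ZMod N) - (b.2 : ZMod N)

/-- Logarithm of `q₁^{j} q₃^{i} v` for the box `b = (i, j)` (numbered from 0). -/
def boxLog (ε τ ℓ : ℂ) (b : ℕ × ℕ) : ℂ := (b.2 : ℂ) * (τ - ε) + (b.1 : ℂ) * (-τ - ε) + ℓ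

/-- Exponent of `: ∏_{(i,j) ∈ λ} η_{i-j}(q₁^{j-1} q₃^{i-1} v) · Φ_∅(v) :`. -/
def phiExponent (N : ℕ) [NeZero N] (ε τ ℓ : ℂ) (lam : YoungDiagram) (m : ℤ) :
    Module.End ℂ (Fock N) :=
  (∑ b ∈ lam.cells, etaExponent N ε τ (color N b) (boxLog ε τ ℓ b) m) + vacuumExponent N ε τ ℓ m

/-- Arm length. -/
def arm (lam : YoungDiagram) (b : ℕ × ℕ) : ℕ := lam.rowLen b.1 - (b.2 + 1)

/-- Leg length. -/
def leg (lam : YoungDiagram) (b : ℕ × ℕ) : ℕ := lam.colLen b.2 - (b.1 + 1)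

/-- `C_λ(q₁, q₃) = ∏_{h(□) ≡ 0} (1 - q₁^{a(□)} q₃^{-ℓ(□)-1})`. -/
def normC (N : ℕ) (ε τ : ℂ) (lam : YoungDiagram) : ℂ :=
  ∏ b ∈ lam.cells with N ∣ arm lam b + leg lam b + 1,
    (1 - exp ((arm lam b : ℂ) * (τ - ε) - ((leg lam b : ℂ) + 1) * (-τ - ε)))

/-- `t_λ(q₁, q₃) = ∏_{h(□) ≡ 0} 𝔮 ∏_{(i,j) ∈ λ, j ≡ 0} (-𝔮 q₁^j)` (with `j` numbered from 1). -/
def normT (N : ℕ) (ε τ : ℂ) (lam : YoungDiagram) : ℂ :=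
  (∏ b ∈ lam.cells with N ∣ arm lam b + leg lam b + 1, exp ε) *
    ∏ b ∈ lam.cells with N ∣ b.2 + 1, -exp (ε + ((b.2 : ℂ) + 1) * (τ - ε))

/-- `|λ|_0`, the number of boxes of colour 0. -/
def countZero (N : ℕ) (lam : YoungDiagram) : ℕ := (lam.cells.filter fun b => color N b = 0).card

/-- The framing factor `f_λ = ∏_{(i,j) ∈ λ, i ≡ j} (-1) q₁^{j-1/2} q₃^{i-1/2}` (numbered from 1). -/
def framing (N : ℕ) (ε τ : ℂ) (lam : YoungDiagram) : ℂ :=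
  ∏ b ∈ lam.cells with color N b = 0,
    -exp (((b.2 : ℂ) + 1 / 2) * (τ - ε) + ((b.1 : ℂ) + 1 / 2) * (-τ - ε))

/-- `e_{i,j}(v) = e^{α_{i-j}} z^{H_{i-j,0} + 1}` with `z = q₁^{j-1} q₃^{i-1} v`. -/
def zeroModeBox (N : ℕ) [NeZero N] (ε τ ℓ : ℂ) (b : ℕ × ℕ) : Module.End ℂ (Fock N) :=
  exp (boxLog ε τ ℓ b) •
    (expOp (simpleRoot N (color N b)) * powH τ (color N b) (boxLog ε τ ℓ b))

/-- The boxes of `λ`, row by row. -/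
def boxList (lam : YoungDiagram) : List (ℕ × ℕ) :=
  (List.range (lam.colLen 0)).flatMap fun i => (List.range (lam.rowLen i)).map fun j => (i, j)

/-- The group algebra part `z_λ(v)`: the product of the `e_{i,j}(v)` in the reversed order, for example
`z_{(3,2)} = e_{2,2} e_{2,1} e_{1,3} e_{1,2} e_{1,1}`. -/
def zLam (N : ℕ) [NeZero N] (ε τ ℓ : ℂ) (lam : YoungDiagram) : Module.End ℂ (Fock N) :=
  ((boxList lam).reverse.map (zeroModeBox N ε τ ℓ)).prod

/-- The component `Φ_λ(v)` of the intertwiner, `v = exp ℓ`, from the horizontal Fock representation of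
level `(1, M)` and spectral parameter `u` to the one of level `(1, M + 1)`:
`Φ_λ(v) = (t_λ / C_λ) u^{|λ|_0} (-v)^{-M |λ|_0} f_λ^{-M-1} z_λ(v) : ∏ η_{i-j}(q₁^{j-1} q₃^{i-1} v) Φ_∅(v) :`,
given by its homogeneous parts. -/
def phi (N : ℕ) [NeZero N] (ε τ ℓ u : ℂ) (M : ℤ) (lam : YoungDiagram) (n : ℤ) :
    Function.End (Fock N) := fun f =>
  (normT N ε τ lam / normC N ε τ lam * u ^ countZero N lam *
      (-exp ℓ) ^ (-M * (countZero N lam : ℤ)) * framing N ε τ lam ^ (-M - 1)) •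
    zLam N ε τ ℓ lam (normalExp (phiExponent N ε τ ℓ lam) n f)

/-! ### Quotients and shifts of a Young diagram -/

/-- The Maya diagram of `λ`: the set of all `k - 1/2`, `k` the momentum of an electron. -/
def maya (lam : YoungDiagram) : Set ℤ := Set.range fun j : ℕ => (lam.colLen j : ℤ) - j - 1

/-- The shift `p_d`: number of holes minus number of electrons in the subsector of colour `d`. -/
def shift (N : ℕ) (lam : YoungDiagram) (d : ZMod N) : ℤ :=
  ({m : ℤ | m < 0 ∧ m ∉ maya lam ∧ (m : ZMod N) = d}.ncard : ℤ) -
    ({m : ℤ | 0 ≤ m ∧ m ∈ maya lam ∧ (m : ZMod N) = d}.ncard : ℤ)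

/-- `μ` is the `d`-th `N`-quotient of `λ`: its Maya diagram is the subsector of colour `d` of that of
`λ`, rescaled by `N` and shifted by `p_d`.  (A Young diagram is determined by its Maya diagram.) -/
def IsQuotient (N : ℕ) (lam : YoungDiagram) (d : ZMod N) (μ : YoungDiagram) : Prop :=
  maya μ = {m : ℤ | (N : ℤ) * (m - shift N lam d) + (d.val : ℤ) ∈ maya lam}

/-! ### The Abelian intertwiner and the modified generators in the unrefined limit -/

/-- The character `ch_μ(Q) = ∑_{(i,j) ∈ μ} Q^{j-i}`. -/
def character (μ : YoungDiagram) (Q : ℂ) : ℂ := ∑ b ∈ μ.cells, Q ^ ((b.2 : ℤ) - (b.1 : ℤ))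

/-- Exponent of the Abelian intertwiner, see `psi`: the term with the generator `H_m`. -/
def psiExponent {V : Type*} [AddCommGroup V] [Module ℂ V] (μ : YoungDiagram) (Q z : ℂ)
    (H : ℤ → Module.End ℂ V) (m : ℤ) : Module.End ℂ V :=
  (((-m : ℤ) : ℂ)⁻¹ * (character μ (Q ^ (-m)) - 1 / ((1 - Q ^ (-m)) * (1 - Q ^ m))) * z ^ (-m)) • H m

/-- The unrefined Abelian (DIM) intertwiner with parameter `Q`, up to a scalar prefactor,
`Ψ_μ^{(Q)}(z, H) = : exp (∑_{r ≥ 1} (1/r) [(ch_μ(Q^r) - 1/((1-Q^{-r})(1-Q^r))) z^r H_{-r} - (r ↔ -r)]) :`,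
for a boson `[H_r, H_s] = (1-Q^r)(1-Q^{-r}) r δ_{r+s,0}`; it is the resummation of
`: ∏_{(i,j) ∈ μ} η(Q^{j-i} z) ∏_{i,j ≥ 1} η(Q^{j-i} z)⁻¹ :` with
`η(z) = : exp (∑_{r ≥ 1} (1/r) (z^r H_{-r} - z^{-r} H_r)) :`. -/
def psi {V : Type*} [AddCommGroup V] [Module ℂ V] (μ : YoungDiagram) (Q z : ℂ)
    (H : ℤ → Module.End ℂ V) (n : ℤ) : Function.End V :=
  normalExp (psiExponent μ Q z H) n

/-- The matrix `L_{cd}(x) = x^{-N ⌊(d-c)/N⌋ - c + d}`, with `c, d` represented in `{0, …, N-1}`. -/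
def matL (N : ℕ) (c d : ZMod N) (x : ℂ) : ℂ :=
  x ^ (-(N : ℤ) * ⌊((d.val : ℚ) - (c.val : ℚ)) / (N : ℚ)⌋ - (c.val : ℤ) + (d.val : ℤ))

/-- The modified Cartan generators `H̃_{d,m} = ∑_c L_{cd}(q₁^{-m}) H_{c,m}` at `𝔮 = 1`, `q₁ = exp τ`. -/
def bosonTilde (N : ℕ) [NeZero N] (τ : ℂ) (d : ZMod N) (m : ℤ) : Module.End ℂ (Fock N) :=
  ∑ c : ZMod N, matL N c d (exp τ ^ (-m)) • boson N 0 τ c m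

/-- The exponent of `q₁` in the `d`-th zero mode factor,
`-N |λ^{(d)}| - N p_d (p_d + 1) / 2 + d p_d + ∑_f ⌊(d-f)/N⌋ p_f`. -/
def zeroExponent (N : ℕ) [NeZero N] (lam : YoungDiagram) (d : ZMod N) (μ : YoungDiagram) : ℤ :=
  -(N : ℤ) * (μ.card : ℤ) - (N : ℤ) * (shift N lam d * (shift N lam d + 1) / 2)
    + (d.val : ℤ) * shift N lam d
    + ∑ f : ZMod N, ⌊((d.val : ℚ) - (f.val : ℚ)) / (N : ℚ)⌋ * shift N lam f

/-- The `d`-th zero mode factor `e^{-p_d α̃_d} (q₁^{k_d} v^{-p_d})^{H̃_{d,0}}`, where `k_d` is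
`zeroExponent`, `q₁ = exp τ`, `v = exp ℓ`. -/
def zeroFactor (N : ℕ) [NeZero N] (τ ℓ : ℂ) (lam : YoungDiagram) (d : ZMod N) (μ : YoungDiagram) :
    Module.End ℂ (Fock N) :=
  expOp (-(shift N lam d) • tildeAlpha N d) *
    powHTilde τ d ((zeroExponent N lam d μ : ℂ) * τ - (shift N lam d : ℂ) * ℓ) (-(shift N lam d))

/-- The exponent of the `d`-th Abelian intertwiner `Ψ^{(q₁^N)}_μ(q₁^{N p_d - d} v, H̃_{d,·})`,
`q₁ = exp τ`, `v = exp ℓ`. -/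
def abelianExponent (N : ℕ) [NeZero N] (τ ℓ : ℂ) (lam : YoungDiagram) (d : ZMod N)
    (μ : YoungDiagram) : ℤ → Module.End ℂ (Fock N) :=
  psiExponent μ (exp τ ^ N) (exp τ ^ ((N : ℤ) * shift N lam d - (d.val : ℤ)) * exp ℓ)
    (bosonTilde N τ d)

/-- The `d`-th Abelian intertwiner `Ψ^{(q₁^N)}_μ(q₁^{N p_d - d} v, H̃_{d,·})`, `q₁ = exp τ`,
`v = exp ℓ`, given by its homogeneous parts. -/
def abelianFactor (N : ℕ) [NeZero N] (τ ℓ : ℂ) (lam : YoungDiagram) (d : ZMod N)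
    (μ : YoungDiagram) (n : ℤ) : Function.End (Fock N) :=
  psi μ (exp τ ^ N) (exp τ ^ ((N : ℤ) * shift N lam d - (d.val : ℤ)) * exp ℓ)
    (bosonTilde N τ d) n

/-- The composition `∏_{d=0}^{N-1} (d-th zero mode factor) (part of degree k_d of the d-th Abelian
intertwiner)`, applied to `x`; the factor with `d = 0` is the leftmost. -/
def productTerm (N : ℕ) [NeZero N] (τ ℓ : ℂ) (lam : YoungDiagram) (μ : ZMod N → YoungDiagram)
    (k : ZMod N → ℤ) (x : Fock N) : Fock N :=
  (List.range N).foldr (fun (d : ℕ) (y : Fock N) =>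
    zeroFactor N τ ℓ lam (d : ZMod N) (μ d) (abelianFactor N τ ℓ lam (d : ZMod N) (μ d) (k d) y)) x

end Toroidal

end

/-!
The proof separates the vertex operators into their oscillator parts and their zero modes.

*Oscillators.* A normal ordered exponential is given by its homogeneous parts.  If all modes of
two exponents commute, the product of their exponentials is, degree by degree, the exponential of
the sum (`normalExp_add`, `finsum_foldr_normalExp`); no completion of the Fock space is needed,
because an annihilation series acts on each vector through finitely many terms.  The matrix `L`
satisfies `L(x)ᵀ C L(x⁻¹) = (1 - x^N)(1 - x^{-N})` for the deformed Cartan matrix `C` and `x =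
q₁^{-r}` (`sum_matL_mul_cartan_mul_matL`).  This gives the commutators of the modified bosons and
also the inverse of `C`, hence the vacuum exponent, as `L(x⁻¹) L(x)ᵀ` up to a scalar.  What
remains is an identity between the exponents (`phiExponent_eq_sum`).

*Zero modes.* Both sides are operators that shift the momentum by a fixed `β` and multiply by `s
exp (χ x)` on momentum `x`, with `χ` additive.  Such operators form a monoid in which `β` and `χ`
add up, and they are determined by `β` and `χ` up to a nonzero scalar (`IsWeyl`); so it suffices
to compare the shifts and the characters.

*Combinatorics.* Every identity needed is an instance of `sum_cells_quotient`.  Adding a box of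
content `c` to a diagram moves a particle of its Maya diagram from `c - 1` to `c`, so for any
function `G` the sum of `G c - G (c - 1)` over the boxes is the sum of `G` over the particles
minus its sum over the vacuum.  Restricting to the positions of colour `d` and rescaling, one
obtains the same expression for the `d`-th quotient and a correction `∑_{0 ≤ m < p_d}` caused by
the shift.  The function `G = 1` gives the momentum shifts, `G n = x^{-n}` a recursion in the
colour that determines the generating function of the boxes of each colour
(`sum_boxes_eq_sum_quotients`), and `G n = ℓ - τ (n + 1/2)` the characters of the zero modes
(`sum_zeroMode_characters`).
-/

namespace Toroidal

/-! ### Exponentials of commuting operator-valued power series -/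

section NormalOrdering

variable {V : Type*} [AddCommGroup V] [Module ℂ V]

theorem coeff_pow_mul_pow_eq_zero {R : Type*} [Semiring R] {g h : PowerSeries R}
    (hg : PowerSeries.coeff 0 g = 0) (hh : PowerSeries.coeff 0 h = 0) {k : ℕ} :
    ∀ {i j : ℕ}, k < i + j → PowerSeries.coeff k (g ^ i * h ^ j) = 0 := by
  have key : ∀ (f : PowerSeries R), PowerSeries.coeff 0 f = 0 → ∀ (F : PowerSeries R) (n : ℕ),
      (∀ k < n, PowerSeries.coeff k F = 0) → ∀ k < n + 1, PowerSeries.coeff k (F * f) = 0 := by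
    intro f hf F n hF k hk
    rw [PowerSeries.coeff_mul]
    refine Finset.sum_eq_zero fun p hp => ?_
    rw [Finset.HasAntidiagonal.mem_antidiagonal] at hp
    rcases Nat.eq_zero_or_pos p.2 with h0 | h0
    · rw [h0, hf, mul_zero]
    · rw [hF p.1 (by omega), zero_mul]
  have hpow : ∀ i, ∀ k < i, PowerSeries.coeff k (g ^ i) = 0 := by
    intro i
    induction i with
    | zero => intro k hk; omega
    | succ i ih => rw [pow_succ]; exact key g hg _ i ih
  intro i j
  induction j generalizing k with
  | zero => intro hk; simpa using hpow i k hk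
  | succ j ih =>
    intro hk
    rw [pow_succ, ← mul_assoc]
    exact key h hh _ (i + j) (fun k hk => ih hk) k hk

theorem coeff_pow_eq_zero {R : Type*} [Semiring R] {g : PowerSeries R}
    (hg : PowerSeries.coeff 0 g = 0) {k j : ℕ} (hk : k < j) :
    PowerSeries.coeff k (g ^ j) = 0 := by
  simpa using coeff_pow_mul_pow_eq_zero hg hg (i := j) (j := 0) hk

theorem expCoeff_eq_sum {g : PowerSeries (Module.End ℂ V)} (hg : PowerSeries.coeff 0 g = 0)
    {k n : ℕ} (hk : k < n) :
    expCoeff g k =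
      ∑ j ∈ Finset.range n, ((j.factorial : ℂ)⁻¹) • PowerSeries.coeff k (g ^ j) := by
  refine Finset.sum_subset (Finset.range_subset_range.2 hk) fun j _ hj => ?_
  rw [Finset.mem_range, not_lt] at hj
  rw [coeff_pow_eq_zero hg (by omega), smul_zero]

/-- The exponential of a sum of commuting series without constant term is the product of the
exponentials. -/
theorem expCoeff_add {g h : PowerSeries (Module.End ℂ V)} (hc : Commute g h)
    (hg : PowerSeries.coeff 0 g = 0) (hh : PowerSeries.coeff 0 h = 0) (k : ℕ) :
    expCoeff (g + h) k =
      ∑ p ∈ Finset.HasAntidiagonal.antidiagonal k, expCoeff g p.1 * expCoeff h p.2 := by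
  set F : ℕ × ℕ → Module.End ℂ V := fun p =>
    ((p.1.factorial : ℂ)⁻¹ * (p.2.factorial : ℂ)⁻¹) • PowerSeries.coeff k (g ^ p.1 * h ^ p.2)
    with hF
  have hl : expCoeff (g + h) k =
      ∑ n ∈ Finset.range (k + 1), ∑ p ∈ Finset.HasAntidiagonal.antidiagonal n, F p := by
    refine Finset.sum_congr rfl fun n _ => ?_
    rw [hc.add_pow', map_sum, Finset.smul_sum]
    refine Finset.sum_congr rfl fun p hp => ?_
    rw [Finset.HasAntidiagonal.mem_antidiagonal] at hp
    rw [map_nsmul, ← Nat.cast_smul_eq_nsmul ℂ, smul_smul, hF]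
    congr 1
    have h := Nat.choose_mul_factorial_mul_factorial (show p.1 ≤ p.1 + p.2 by omega)
    rw [Nat.add_sub_cancel_left] at h
    have h0 : (((p.1 + p.2).factorial : ℕ) : ℂ) ≠ 0 := Nat.cast_ne_zero.2 (Nat.factorial_ne_zero _)
    have h1 : ((p.1.factorial : ℕ) : ℂ) ≠ 0 := Nat.cast_ne_zero.2 (Nat.factorial_ne_zero _)
    have h2 : ((p.2.factorial : ℕ) : ℂ) ≠ 0 := Nat.cast_ne_zero.2 (Nat.factorial_ne_zero _)
    rw [← hp, inv_mul_eq_iff_eq_mul₀ h0, ← h]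
    push_cast
    field_simp
  have hr : ∑ p ∈ Finset.HasAntidiagonal.antidiagonal k, expCoeff g p.1 * expCoeff h p.2 =
      ∑ p ∈ Finset.range (k + 1) ×ˢ Finset.range (k + 1), F p := by
    have : ∀ p ∈ Finset.HasAntidiagonal.antidiagonal k, expCoeff g p.1 * expCoeff h p.2 =
        ∑ q ∈ Finset.range (k + 1) ×ˢ Finset.range (k + 1),
          ((q.1.factorial : ℂ)⁻¹ * (q.2.factorial : ℂ)⁻¹) •
            (PowerSeries.coeff p.1 (g ^ q.1) * PowerSeries.coeff p.2 (h ^ q.2)) := by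
      intro p hp
      rw [Finset.HasAntidiagonal.mem_antidiagonal] at hp
      rw [expCoeff_eq_sum hg (show p.1 < k + 1 by omega),
        expCoeff_eq_sum hh (show p.2 < k + 1 by omega), Finset.sum_mul_sum, Finset.sum_product]
      refine Finset.sum_congr rfl fun i _ => Finset.sum_congr rfl fun j _ => ?_
      rw [smul_mul_smul_comm]
    rw [Finset.sum_congr rfl this, Finset.sum_comm]
    refine Finset.sum_congr rfl fun q _ => ?_
    simp only [hF, PowerSeries.coeff_mul, Finset.smul_sum]
  rw [hl, hr]
  -- the terms of the square above its diagonal vanish for degree reasons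
  have hs : ∑ p ∈ Finset.range (k + 1) ×ˢ Finset.range (k + 1), F p =
      ∑ p ∈ (Finset.range (k + 1) ×ˢ Finset.range (k + 1)) with p.1 + p.2 < k + 1, F p := by
    symm
    refine Finset.sum_subset (Finset.filter_subset _ _) fun p hp hp' => ?_
    rw [Finset.mem_filter, not_and, not_lt] at hp'
    rw [hF]
    simp only
    rw [coeff_pow_mul_pow_eq_zero hg hh (by have := hp' hp; omega), smul_zero]
  rw [hs, ← Finset.sum_fiberwise_of_maps_to (g := fun p : ℕ × ℕ => p.1 + p.2)
    (t := Finset.range (k + 1)) (by intro p hp; simpa using (Finset.mem_filter.1 hp).2)]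
  refine Finset.sum_congr rfl fun n hn => Finset.sum_congr ?_ fun _ _ => rfl
  ext p
  simp only [Finset.mem_range, Finset.HasAntidiagonal.mem_antidiagonal, Finset.mem_filter,
    Finset.mem_product] at *
  omega

/-- An operator that commutes with all coefficients of a series commutes with its exponential. -/
theorem commute_expCoeff {T : Module.End ℂ V} {g : PowerSeries (Module.End ℂ V)}
    (hT : ∀ k, Commute T (PowerSeries.coeff k g)) (k : ℕ) : Commute T (expCoeff g k) := by
  have hpow : ∀ j k, Commute T (PowerSeries.coeff k (g ^ j)) := by
    intro j
    induction j with
    | zero =>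
      intro k
      rw [pow_zero, PowerSeries.coeff_one]
      split_ifs
      · exact Commute.one_right _
      · exact Commute.zero_right _
    | succ j ih =>
      intro k
      rw [pow_succ, PowerSeries.coeff_mul]
      exact Commute.sum_right _ _ _ fun p _ => (ih p.1).mul_right (hT p.2)
  exact Commute.sum_right _ _ _ fun j _ => (hpow j k).smul_right _

theorem commute_powerSeries {R : Type*} [Semiring R] {g h : PowerSeries R}
    (hc : ∀ i j, Commute (PowerSeries.coeff i g) (PowerSeries.coeff j h)) : Commute g h := by
  ext n
  rw [PowerSeries.coeff_mul, PowerSeries.coeff_mul, ← Finset.Nat.sum_antidiagonal_swap]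
  exact Finset.sum_congr rfl fun p _ => hc _ _

/-! ### Normal ordered exponentials -/

theorem coeff_creationSeries (X : ℤ → Module.End ℂ V) (r : ℕ) :
    PowerSeries.coeff r (creationSeries X) = if r = 0 then 0 else X (-(r : ℤ)) :=
  PowerSeries.coeff_mk _ _

theorem coeff_annihilationSeries (X : ℤ → Module.End ℂ V) (r : ℕ) :
    PowerSeries.coeff r (annihilationSeries X) = if r = 0 then 0 else X (r : ℤ) :=
  PowerSeries.coeff_mk _ _

theorem creationSeries_add (X Y : ℤ → Module.End ℂ V) :
    creationSeries (X + Y) = creationSeries X + creationSeries Y := by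
  ext r : 1
  simp only [map_add, coeff_creationSeries]
  split_ifs <;> simp

theorem annihilationSeries_add (X Y : ℤ → Module.End ℂ V) :
    annihilationSeries (X + Y) = annihilationSeries X + annihilationSeries Y := by
  ext r : 1
  simp only [map_add, coeff_annihilationSeries]
  split_ifs <;> simp

/-- The homogeneous part of degree `n` of `exp (∑_{r ≥ 1} X_{-r})`, with `n` any integer. -/
noncomputable def creationCoeff (X : ℤ → Module.End ℂ V) (n : ℤ) : Module.End ℂ V :=
  if 0 ≤ n then expCoeff (creationSeries X) n.toNat else 0

theorem normalExp_eq (X : ℤ → Module.End ℂ V) (n : ℤ) (f : V) :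
    normalExp X n f =
      ∑ᶠ l : ℕ, creationCoeff X (n + l) (expCoeff (annihilationSeries X) l f) := by
  refine finsum_congr fun l => ?_
  rw [creationCoeff]
  split_ifs <;> rfl

theorem commute_annihilation {T : Module.End ℂ V} {X : ℤ → Module.End ℂ V}
    (hT : ∀ m, Commute T (X m)) (l : ℕ) : Commute T (expCoeff (annihilationSeries X) l) := by
  refine commute_expCoeff (fun k => ?_) l
  rw [coeff_annihilationSeries]
  split_ifs
  · exact Commute.zero_right _
  · exact hT _

theorem commute_creation {T : Module.End ℂ V} {X : ℤ → Module.End ℂ V}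
    (hT : ∀ m, Commute T (X m)) (n : ℤ) : Commute T (creationCoeff X n) := by
  rw [creationCoeff]
  split_ifs
  · refine commute_expCoeff (fun k => ?_) _
    rw [coeff_creationSeries]
    split_ifs
    · exact Commute.zero_right _
    · exact hT _
  · exact Commute.zero_right _

theorem expCoeff_annihilation_add {X Y : ℤ → Module.End ℂ V} (hc : ∀ m n, Commute (X m) (Y n))
    (l : ℕ) : expCoeff (annihilationSeries (X + Y)) l = ∑ p ∈ Finset.HasAntidiagonal.antidiagonal l,
      expCoeff (annihilationSeries X) p.1 * expCoeff (annihilationSeries Y) p.2 := by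
  rw [annihilationSeries_add]
  refine expCoeff_add (commute_powerSeries fun i j => ?_) ?_ ?_ l
  · rw [coeff_annihilationSeries, coeff_annihilationSeries]
    split_ifs <;> simp [hc _ _]
  all_goals simp [coeff_annihilationSeries]

theorem creationCoeff_add {X Y : ℤ → Module.End ℂ V} (hc : ∀ m n, Commute (X m) (Y n))
    (n : ℤ) (f : V) : (Function.support fun a : ℤ =>
        creationCoeff X a (creationCoeff Y (n - a) f)).Finite ∧
      ∑ᶠ a : ℤ, creationCoeff X a (creationCoeff Y (n - a) f) = creationCoeff (X + Y) n f := by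
  have hsupp : (Function.support fun a : ℤ => creationCoeff X a (creationCoeff Y (n - a) f)) ⊆
      (Finset.Icc 0 n : Finset ℤ) := by
    intro a ha
    rw [Finset.coe_Icc, Set.mem_Icc]
    by_contra hcon
    apply ha
    simp only [creationCoeff]
    by_cases h0 : 0 ≤ a
    · rw [if_neg (show ¬ 0 ≤ n - a by omega)]
      simp
    · rw [if_neg h0]
      simp
  refine ⟨(Finset.finite_toSet _).subset hsupp, ?_⟩
  rw [finsum_eq_sum_of_support_subset _ hsupp]
  by_cases hn : 0 ≤ n
  · lift n to ℕ using hn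
    have h1 : (Finset.Icc 0 (n : ℤ)) = (Finset.range (n + 1)).map Nat.castEmbedding := by
      ext a
      simp only [Finset.mem_Icc, Finset.mem_map, Finset.mem_range, Nat.castEmbedding_apply]
      constructor
      · intro h; exact ⟨a.toNat, by omega, by omega⟩
      · rintro ⟨b, hb, rfl⟩; omega
    rw [h1, Finset.sum_map, creationCoeff, if_pos (by omega), creationSeries_add, Int.toNat_natCast,
      expCoeff_add (commute_powerSeries fun i j => ?_) (by simp [coeff_creationSeries])
        (by simp [coeff_creationSeries]),
      Finset.Nat.sum_antidiagonal_eq_sum_range_succ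
        (fun i j => expCoeff (creationSeries X) i * expCoeff (creationSeries Y) j),
      LinearMap.sum_apply]
    · refine Finset.sum_congr rfl fun a ha => ?_
      rw [Finset.mem_range] at ha
      rw [Nat.castEmbedding_apply, creationCoeff, creationCoeff, if_pos (by omega),
        if_pos (by omega), Int.toNat_natCast, show ((n : ℤ) - a).toNat = n - a by omega]
      rfl
    · rw [coeff_creationSeries, coeff_creationSeries]
      split_ifs <;> simp [hc _ _]
  · rw [creationCoeff, if_neg hn, Finset.Icc_eq_empty (by omega)]
    simp

theorem NormalOrderable.exists_bound {X : ℤ → Module.End ℂ V} (hX : NormalOrderable X) (f : V) :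
    ∃ L : ℕ, ∀ l, L ≤ l → expCoeff (annihilationSeries X) l f = 0 := by
  obtain ⟨L, hL⟩ := (hX f).bddAbove
  refine ⟨L + 1, fun l hl => ?_⟩
  by_contra h
  have : l ≤ L := hL h
  omega

theorem normalExp_eq_sum {X : ℤ → Module.End ℂ V} {f : V} {L : ℕ}
    (hL : ∀ l, L ≤ l → expCoeff (annihilationSeries X) l f = 0) (n : ℤ) :
    normalExp X n f = ∑ l ∈ Finset.range L,
      creationCoeff X (n + l) (expCoeff (annihilationSeries X) l f) := by
  rw [normalExp_eq]
  refine finsum_eq_sum_of_support_subset _ fun l hl => ?_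
  rw [Finset.coe_range, Set.mem_Iio]
  by_contra h
  exact hl (by simp only [hL l (not_lt.1 h), map_zero])

/-- The homogeneous parts of a normal ordered exponential as linear operators. -/
noncomputable def normalExpLin (X : ℤ → Module.End ℂ V) (hX : NormalOrderable X) (n : ℤ) :
    Module.End ℂ V where
  toFun := normalExp X n
  map_add' f g := by
    obtain ⟨L, hL⟩ := hX.exists_bound f
    obtain ⟨M, hM⟩ := hX.exists_bound g
    rw [normalExp_eq_sum (L := max L M) fun l hl => hL l (le_of_max_le_left hl),
      normalExp_eq_sum (L := max L M) fun l hl => hM l (le_of_max_le_right hl),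
      normalExp_eq_sum (L := max L M), ← Finset.sum_add_distrib]
    · simp
    · intro l hl
      rw [map_add, hL l (le_of_max_le_left hl), hM l (le_of_max_le_right hl), add_zero]
  map_smul' c f := by
    obtain ⟨L, hL⟩ := hX.exists_bound f
    rw [normalExp_eq_sum hL, normalExp_eq_sum (L := L) fun l hl => by
      rw [map_smul, hL l hl, smul_zero], Finset.smul_sum]
    simp

theorem normalExpLin_apply {X : ℤ → Module.End ℂ V} (hX : NormalOrderable X) (n : ℤ) (f : V) :
    normalExpLin X hX n f = normalExp X n f := rfl

theorem commute_normalExpLin {T : Module.End ℂ V} {X : ℤ → Module.End ℂ V}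
    (hX : NormalOrderable X) (hT : ∀ m, Commute T (X m)) (n : ℤ) :
    Commute T (normalExpLin X hX n) := by
  refine LinearMap.ext fun f => ?_
  obtain ⟨L, hL⟩ := hX.exists_bound f
  have hA : ∀ l (f : V), T (expCoeff (annihilationSeries X) l f) =
      expCoeff (annihilationSeries X) l (T f) := fun l f =>
    LinearMap.congr_fun (commute_annihilation hT l) f
  have hC : ∀ m (f : V), T (creationCoeff X m f) = creationCoeff X m (T f) := fun m f =>
    LinearMap.congr_fun (commute_creation hT m) f
  change T (normalExp X n f) = normalExp X n (T f)
  rw [normalExp_eq_sum hL, normalExp_eq_sum (L := L) fun l hl => by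
    rw [← hA, hL l hl, map_zero], map_sum]
  exact Finset.sum_congr rfl fun l _ => by rw [hC, hA]

theorem commute_normalExpLin_normalExpLin {X Y : ℤ → Module.End ℂ V} (hX : NormalOrderable X)
    (hY : NormalOrderable Y) (hc : ∀ m n, Commute (X m) (Y n)) (m n : ℤ) :
    Commute (normalExpLin X hX m) (normalExpLin Y hY n) :=
  commute_normalExpLin hY
    (fun k => (commute_normalExpLin hX (fun j => (hc j k).symm) m).symm) n

theorem NormalOrderable.add {X Y : ℤ → Module.End ℂ V} (hX : NormalOrderable X)
    (hY : NormalOrderable Y) (hc : ∀ m n, Commute (X m) (Y n)) : NormalOrderable (X + Y) := by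
  intro f
  obtain ⟨L, hL⟩ := hX.exists_bound f
  obtain ⟨M, hM⟩ := hY.exists_bound f
  refine (Set.finite_lt_nat (L + M)).subset fun l hl => ?_
  by_contra h
  rw [Set.mem_ofPred_eq, not_lt] at h
  apply hl
  rw [expCoeff_annihilation_add hc, LinearMap.sum_apply]
  refine Finset.sum_eq_zero fun p hp => ?_
  rw [Finset.HasAntidiagonal.mem_antidiagonal] at hp
  by_cases h2 : M ≤ p.2
  · rw [Module.End.mul_apply, hM _ h2, map_zero]
  · have := commute_annihilation (T := expCoeff (annihilationSeries X) p.1) (X := Y)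
      (fun m => (commute_annihilation (fun j => (hc j m).symm) p.1).symm) p.2
    rw [this.eq, Module.End.mul_apply, hL _ (by omega), map_zero]

/-- The normal ordered exponential of a sum of two mutually commuting families is the product of the
normal ordered exponentials, degree by degree. -/
theorem normalExp_add {X Y : ℤ → Module.End ℂ V} (hX : NormalOrderable X)
    (hY : NormalOrderable Y) (hc : ∀ m n, Commute (X m) (Y n)) (n : ℤ) (f : V) :
    ∑ᶠ a : ℤ, normalExp X a (normalExp Y (n - a) f) = normalExp (X + Y) n f := by
  obtain ⟨L, hL⟩ := hX.exists_bound f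
  obtain ⟨M, hM⟩ := hY.exists_bound f
  set A := expCoeff (annihilationSeries X) with hAdef
  set B := expCoeff (annihilationSeries Y) with hBdef
  have hXB : ∀ m j, Commute (X m) (B j) := fun m j => commute_annihilation (hc m) j
  have hAB : ∀ i j, Commute (A i) (B j) := fun i j =>
    (commute_annihilation (fun m => (hXB m j).symm) i).symm
  have hAC : ∀ i m, Commute (A i) (creationCoeff Y m) := fun i m =>
    commute_creation (fun k => (commute_annihilation (fun j => (hc j k).symm) i).symm) m
  -- move the annihilation part of `X` past the creation part of `Y`; both annihilation sums are
  -- finite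
  have hterm : ∀ a : ℤ, normalExp X a (normalExp Y (n - a) f) =
      ∑ q ∈ Finset.range L ×ˢ Finset.range M, creationCoeff X (a + q.1)
        (creationCoeff Y (n - a + q.2) (A q.1 (B q.2 f))) := by
    intro a
    have hcomm : ∀ l, A l (normalExp Y (n - a) f) = normalExp Y (n - a) (A l f) := fun l =>
      LinearMap.congr_fun (commute_normalExpLin hY
        (fun m => (commute_annihilation (fun j => (hc j m).symm) l).symm) (n - a)) f
    rw [normalExp_eq_sum (L := L), Finset.sum_product]
    · refine Finset.sum_congr rfl fun i _ => ?_
      rw [normalExp_eq_sum hM, map_sum, map_sum]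
      refine Finset.sum_congr rfl fun j _ => ?_
      congr 1
      exact LinearMap.congr_fun (hAC i _) _
    · intro l hl
      change A l _ = 0
      rw [hcomm, hL l hl]
      exact map_zero (normalExpLin Y hY (n - a))
  have hsum : ∀ q : ℕ × ℕ, (Function.support fun a : ℤ => creationCoeff X (a + q.1)
        (creationCoeff Y (n - a + q.2) (A q.1 (B q.2 f)))).Finite ∧
      ∑ᶠ a : ℤ, creationCoeff X (a + q.1) (creationCoeff Y (n - a + q.2) (A q.1 (B q.2 f))) =
        creationCoeff (X + Y) (n + (q.1 + q.2 : ℕ)) (A q.1 (B q.2 f)) := by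
    intro q
    obtain ⟨h1, h2⟩ := creationCoeff_add hc (n + (q.1 + q.2 : ℕ)) (A q.1 (B q.2 f))
    have he : (fun a : ℤ => creationCoeff X (a + q.1)
        (creationCoeff Y (n - a + q.2) (A q.1 (B q.2 f)))) =
        (fun a : ℤ => creationCoeff X a (creationCoeff Y (n + (q.1 + q.2 : ℕ) - a)
          (A q.1 (B q.2 f)))) ∘ Equiv.addRight (q.1 : ℤ) := by
      funext a
      simp only [Function.comp_apply, Equiv.coe_addRight]
      congr 3
      push_cast
      ring
    constructor
    · rw [he, Function.support_comp_eq_preimage]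
      exact h1.preimage (Equiv.injective _).injOn
    · rw [← h2, he]
      exact finsum_comp_equiv (Equiv.addRight (q.1 : ℤ)) (f := fun a : ℤ => creationCoeff X a
        (creationCoeff Y (n + (q.1 + q.2 : ℕ) - a) (A q.1 (B q.2 f))))
  rw [finsum_congr hterm, finsum_sum_comm _ _ fun q _ => (hsum q).1,
    Finset.sum_congr rfl fun q _ => (hsum q).2]
  have hzero : ∀ q : ℕ × ℕ, ¬ (q.1 < L ∧ q.2 < M) → A q.1 (B q.2 f) = 0 := by
    intro q hq
    by_cases h2 : M ≤ q.2
    · rw [hM _ h2, map_zero]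
    · have h3 : A q.1 (B q.2 f) = B q.2 (A q.1 f) := LinearMap.congr_fun (hAB _ _) f
      rw [h3, hL _ (by omega), map_zero]
  rw [normalExp_eq_sum (L := L + M)]
  · have hr : ∀ l ∈ Finset.range (L + M), creationCoeff (X + Y) (n + l)
        (expCoeff (annihilationSeries (X + Y)) l f) = ∑ q ∈ Finset.range L ×ˢ Finset.range M
          with q.1 + q.2 = l, creationCoeff (X + Y) (n + (q.1 + q.2 : ℕ)) (A q.1 (B q.2 f)) := by
      intro l _
      rw [expCoeff_annihilation_add hc, LinearMap.sum_apply, map_sum]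
      symm
      refine Finset.sum_subset_zero_on_sdiff ?_ ?_ ?_
      · intro q hq
        rw [Finset.mem_filter] at hq
        exact Finset.HasAntidiagonal.mem_antidiagonal.2 hq.2
      · intro q hq
        rw [Finset.mem_sdiff, Finset.HasAntidiagonal.mem_antidiagonal, Finset.mem_filter,
          Finset.mem_product,
          Finset.mem_range, Finset.mem_range] at hq
        change creationCoeff (X + Y) _ (A q.1 (B q.2 f)) = 0
        rw [hzero q (by tauto), map_zero]
      · intro q hq
        rw [(Finset.mem_filter.1 hq).2]
        rfl
    rw [Finset.sum_congr rfl hr, Finset.sum_fiberwise_of_maps_to]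
    intro q hq
    rw [Finset.mem_product, Finset.mem_range, Finset.mem_range] at hq
    rw [Finset.mem_range]
    omega
  · intro l hl
    rw [expCoeff_annihilation_add hc, LinearMap.sum_apply]
    refine Finset.sum_eq_zero fun p hp => ?_
    rw [Finset.HasAntidiagonal.mem_antidiagonal] at hp
    exact hzero p (by omega)

end NormalOrdering

/-! ### Products of finitely many normal ordered exponentials -/

section NormalOrdering

variable {V : Type*} [AddCommGroup V] [Module ℂ V]

theorem expCoeff_zero_series (l : ℕ) :
    expCoeff (0 : PowerSeries (Module.End ℂ V)) l = if l = 0 then 1 else 0 := by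
  rw [expCoeff, Finset.sum_eq_single 0]
  · rw [pow_zero, PowerSeries.coeff_one]
    simp
  · intro j _ hj
    rw [zero_pow hj, map_zero, smul_zero]
  · simp

theorem annihilationSeries_zero : annihilationSeries (0 : ℤ → Module.End ℂ V) = 0 := by
  ext r : 1
  simp [coeff_annihilationSeries]

theorem creationSeries_zero : creationSeries (0 : ℤ → Module.End ℂ V) = 0 := by
  ext r : 1
  simp [coeff_creationSeries]

theorem normalOrderable_zero : NormalOrderable (0 : ℤ → Module.End ℂ V) := by
  intro f
  refine (Set.finite_singleton 0).subset fun l hl => ?_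
  by_contra h
  apply hl
  rw [annihilationSeries_zero, expCoeff_zero_series,
    if_neg fun h0 : l = 0 => h (Set.mem_singleton_iff.2 h0), LinearMap.zero_apply]

theorem normalExp_zero (n : ℤ) (f : V) :
    normalExp (0 : ℤ → Module.End ℂ V) n f = if n = 0 then f else 0 := by
  rw [normalExp_eq_sum (L := 1), Finset.sum_range_one, annihilationSeries_zero,
    expCoeff_zero_series, if_pos rfl, creationCoeff, creationSeries_zero, expCoeff_zero_series,
    Module.End.one_apply]
  · by_cases h : n = 0
    · simp [h]
    · rw [if_neg h]
      split_ifs with h1 h2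
      · simp at h1 h2; omega
      · rfl
      · rfl
  · intro l hl
    rw [annihilationSeries_zero, expCoeff_zero_series, if_neg (by omega), LinearMap.zero_apply]

theorem commute_foldr {ι : Type*} {T : Module.End ℂ V} {E : ι → Module.End ℂ V} {ds : List ι}
    (h : ∀ d ∈ ds, Commute T (E d)) (x : V) :
    T (ds.foldr (fun d y => E d y) x) = ds.foldr (fun d y => E d y) (T x) := by
  induction ds with
  | nil => rfl
  | cons e ds ih =>
    rw [List.foldr_cons, List.foldr_cons, ← ih fun d hd => h d (List.mem_cons_of_mem _ hd)]
    exact LinearMap.congr_fun (h e List.mem_cons_self) _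

theorem foldr_map_zero {ι : Type*} (E : ι → Module.End ℂ V) (ds : List ι) :
    ds.foldr (fun d y => E d y) 0 = 0 := by
  induction ds with
  | nil => rfl
  | cons e ds ih => rw [List.foldr_cons, ih, map_zero]

theorem foldr_eq_zero_of_commute {ι : Type*} {E : ι → Module.End ℂ V} {ds : List ι} {d : ι}
    (hd : d ∈ ds) (hc : ∀ e, e ≠ d → Commute (E d) (E e)) (hn : ds.Nodup) {x : V}
    (hx : E d x = 0) : ds.foldr (fun d y => E d y) x = 0 := by
  induction ds with
  | nil => simp at hd
  | cons e ds ih =>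
    rw [List.nodup_cons] at hn
    rw [List.foldr_cons]
    rcases List.mem_cons.1 hd with rfl | hd'
    · rw [commute_foldr (fun e he => hc e fun h => hn.1 (h ▸ he)), hx, foldr_map_zero]
    · rw [ih hd' hn.2, map_zero]

/-- Operators that commute with the `E d` can be collected to the left of their product. -/
theorem foldr_mul_of_commute {ι : Type*} {Z E : ι → Module.End ℂ V} (ds : List ι)
    (hc : ∀ d e, Commute (Z d) (E e)) (x : V) :
    ds.foldr (fun d y => Z d (E d y)) x =
      (ds.map Z).prod (ds.foldr (fun d y => E d y) x) := by
  induction ds with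
  | nil => rfl
  | cons e ds ih =>
    rw [List.foldr_cons, List.foldr_cons, ih, List.map_cons, List.prod_cons, Module.End.mul_apply]
    congr 1
    exact (LinearMap.congr_fun (Commute.list_prod_left _ _ fun z hz => by
      obtain ⟨d, _, rfl⟩ := List.mem_map.1 hz
      exact hc d e) _).symm

/-- Only finitely many tuples of degrees with a given sum contribute on a given vector: the parts of
very negative degree kill it, as the factors commute. -/
theorem finite_setOf_foldr_ne_zero {n : ℕ} {X : Fin n → ℤ → Module.End ℂ V}
    (hX : ∀ d, NormalOrderable (X d))
    (hc : ∀ d e, d ≠ e → ∀ m k, Commute (X d m) (X e k)) (m : ℤ) (x : V) :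
    {k : Fin n → ℤ | ∑ d, k d = m ∧
      (List.finRange n).foldr (fun d y => normalExp (X d) (k d) y) x ≠ 0}.Finite := by
  choose L hL using fun d => (hX d).exists_bound x
  have hzero : ∀ d (a : ℤ), a < -(L d : ℤ) → normalExp (X d) a x = 0 := by
    intro d a ha
    rw [normalExp_eq_sum (hL d)]
    refine Finset.sum_eq_zero fun l hl => ?_
    rw [Finset.mem_range] at hl
    rw [creationCoeff, if_neg (by omega), LinearMap.zero_apply]
  refine (Set.Finite.pi' (t := fun d => Set.Icc (-(L d : ℤ)) (m + ∑ e, (L e : ℤ)))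
    fun d => Set.finite_Icc _ _).subset ?_
  rintro k ⟨hk, hne⟩ d
  have hlow : ∀ d, -(L d : ℤ) ≤ k d := by
    intro d
    by_contra h
    refine hne (foldr_eq_zero_of_commute (E := fun d => normalExpLin (X d) (hX d) (k d)) (d := d)
      (List.mem_finRange d) (fun e he => ?_) (List.nodup_finRange n) (hzero d _ (not_le.1 h)))
    exact commute_normalExpLin_normalExpLin _ _ (hc d e he.symm) _ _
  refine ⟨hlow d, ?_⟩
  have h1 := Finset.single_le_sum (f := fun e => k e + (L e : ℤ)) (fun e _ => by
    have := hlow e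
    linarith) (Finset.mem_univ d)
  rw [Finset.sum_add_distrib, hk] at h1
  have h2 : (0 : ℤ) ≤ L d := Int.natCast_nonneg _
  linarith

theorem commute_finset_sum_apply {ι : Type*} {s : Finset ι} {X : ι → ℤ → Module.End ℂ V}
    {T : Module.End ℂ V} {k : ℤ} (h : ∀ e ∈ s, Commute T (X e k)) :
    Commute T ((∑ e ∈ s, X e) k) := by
  rw [Finset.sum_apply]
  exact Commute.sum_right _ _ _ h

/-- A product of mutually commuting normal ordered exponentials is, degree by degree, the normal
ordered exponential of the sum of the exponents. -/
theorem finsum_foldr_normalExp : ∀ {n : ℕ} {X : Fin n → ℤ → Module.End ℂ V},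
    (∀ d, NormalOrderable (X d)) → (∀ d e, d ≠ e → ∀ m k, Commute (X d m) (X e k)) →
    NormalOrderable (∑ d, X d) ∧ ∀ (m : ℤ) (x : V),
      (∑ᶠ k : Fin n → ℤ, if ∑ d, k d = m then
        (List.finRange n).foldr (fun d y => normalExp (X d) (k d) y) x else 0) =
      normalExp (∑ d, X d) m x := by
  intro n
  induction n with
  | zero =>
    intro X _ _
    refine ⟨by simpa using normalOrderable_zero, fun m x => ?_⟩
    rw [Fin.sum_univ_zero, normalExp_zero, finsum_eq_sum_of_fintype, Fintype.sum_unique,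
      Fin.sum_univ_zero]
    simp only [eq_comm, List.finRange_zero, List.foldr_nil]
  | succ n ih =>
    intro X hX hc
    obtain ⟨ih1, ih2⟩ := ih (X := fun d => X d.succ) (fun d => hX _)
      (fun d e hde => hc _ _ fun h => hde (Fin.succ_injective _ h))
    have hc0 : ∀ m k, Commute (X 0 m) ((∑ d : Fin n, X d.succ) k) := fun m k =>
      commute_finset_sum_apply fun e _ => hc _ _ (Fin.succ_ne_zero e).symm _ _
    rw [Fin.sum_univ_succ]
    refine ⟨(hX 0).add ih1 hc0, fun m x => ?_⟩
    rw [← normalExp_add (hX 0) ih1 hc0, ← finsum_comp_equiv (Fin.consEquiv fun _ => ℤ),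
      finsum_curry]
    · refine finsum_congr fun a => ?_
      rw [← ih2]
      have hmap := AddMonoidHom.map_finsum (normalExpLin (X 0) (hX 0) a).toAddMonoidHom
        (f := fun k : Fin n → ℤ => if ∑ d, k d = m - a then
          (List.finRange n).foldr (fun d y => normalExp (X d.succ) (k d) y) x else 0) ?_
      · refine Eq.trans (finsum_congr fun k => ?_) hmap.symm
        change (if ∑ d, (Fin.cons a k : Fin (n + 1) → ℤ) d = m then _ else _) =
          normalExpLin (X 0) (hX 0) a (if _ then _ else _)
        rw [Fin.sum_univ_succ, Fin.cons_zero, List.finRange_succ, List.foldr_cons, List.foldr_map,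
          apply_ite (normalExpLin (X 0) (hX 0) a), map_zero]
        simp only [Fin.cons_succ]
        exact if_congr (by constructor <;> intro h <;> linarith) rfl rfl
      · refine (finite_setOf_foldr_ne_zero (X := fun d : Fin n => X d.succ) (fun d => hX _)
          (fun d e hde => hc _ _ fun h => hde (Fin.succ_injective _ h)) (m - a) x).subset ?_
        intro k hk
        by_contra hcon
        apply hk
        simp only
        split_ifs with h
        · by_contra h'
          exact hcon ⟨h, h'⟩
        · rfl
    · refine ((finite_setOf_foldr_ne_zero hX hc m x).preimage
        (Fin.consEquiv fun _ => ℤ).injective.injOn).subset ?_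
      intro k hk
      by_contra hcon
      apply hk
      simp only
      split_ifs with h
      · by_contra h'
        exact hcon ⟨h, h'⟩
      · rfl

/-- A family of operators in which `X_r` lowers an exhaustive filtration that vanishes in negative
degrees by `r` can be normal ordered. -/
theorem normalOrderable_of_filtration {X : ℤ → Module.End ℂ V} (W : ℤ → Submodule ℂ V)
    (hW : ∀ f, ∃ D, f ∈ W D) (hneg : ∀ D < 0, W D = ⊥)
    (hX : ∀ r : ℕ, 0 < r → ∀ D, ∀ f ∈ W D, X r f ∈ W (D - r)) : NormalOrderable X := by
  have hpow : ∀ (j l : ℕ) (D : ℤ), ∀ f ∈ W D,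
      PowerSeries.coeff l (annihilationSeries X ^ j) f ∈ W (D - l) := by
    intro j
    induction j with
    | zero =>
      intro l D f hf
      rw [pow_zero, PowerSeries.coeff_one]
      split_ifs with h
      · simpa [h] using hf
      · exact Submodule.zero_mem _
    | succ j ih =>
      intro l D f hf
      rw [pow_succ, PowerSeries.coeff_mul, LinearMap.sum_apply]
      refine Submodule.sum_mem _ fun p hp => ?_
      rw [Finset.HasAntidiagonal.mem_antidiagonal] at hp
      rw [Module.End.mul_apply, coeff_annihilationSeries]
      split_ifs with h
      · rw [LinearMap.zero_apply, map_zero]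
        exact Submodule.zero_mem _
      · have h1 := ih p.1 _ _ (hX p.2 (Nat.pos_of_ne_zero h) D f hf)
        rwa [show D - (p.2 : ℤ) - p.1 = D - l by omega] at h1
  intro f
  obtain ⟨D, hD⟩ := hW f
  refine (Set.finite_le_nat D.toNat).subset fun l hl => ?_
  by_contra h
  rw [Set.mem_ofPred_eq, not_le] at h
  apply hl
  have h1 : expCoeff (annihilationSeries X) l f ∈ W (D - l) := by
    rw [expCoeff, LinearMap.sum_apply]
    exact Submodule.sum_mem _ fun j _ => Submodule.smul_mem _ _ (hpow j l D f hD)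
  rw [hneg _ (by omega)] at h1
  exact (Submodule.mem_bot ℂ).1 h1

end NormalOrdering

/-! ### Maya diagrams and their quotients -/

/-- The content `i - j` of the box `(i, j)`. -/
def content (b : ℕ × ℕ) : ℤ := (b.1 : ℤ) - b.2

/-- The indicator function of the Maya diagram of `lam` minus that of the vacuum `{m : m < 0}`,
written as a sum over boxes: adding a box of content `c` moves a particle from `c - 1` to `c`. -/
noncomputable def chargeProfile (lam : YoungDiagram) : ℤ →₀ ℤ :=
  ∑ b ∈ lam.cells, (Finsupp.single (content b) 1 - Finsupp.single (content b - 1) 1)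

/-- The indicator function of `{m : m < p}` minus that of `{m : m < 0}`. -/
noncomputable def stepProfile (p : ℤ) : ℤ →₀ ℤ :=
  ∑ m ∈ Finset.Ico 0 p, Finsupp.single m 1 - ∑ m ∈ Finset.Ico p 0, Finsupp.single m 1

theorem sum_cells_eq_sum_columns {A : Type*} [AddCommMonoid A] (lam : YoungDiagram) {J : ℕ}
    (hJ : lam.rowLen 0 ≤ J) (F : ℕ × ℕ → A) :
    ∑ b ∈ lam.cells, F b = ∑ j ∈ Finset.range J, ∑ i ∈ Finset.range (lam.colLen j), F (i, j) := by
  rw [Finset.sum_sigma']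
  refine Finset.sum_nbij' (fun b => ⟨b.2, b.1⟩) (fun s => (s.2, s.1)) ?_ ?_ ?_ ?_ ?_
  · rintro ⟨i, j⟩ hb
    rw [YoungDiagram.mem_cells] at hb
    have h1 : (0, j) ∈ lam := lam.up_left_mem (Nat.zero_le _) le_rfl hb
    rw [YoungDiagram.mem_iff_lt_rowLen] at h1
    rw [YoungDiagram.mem_iff_lt_colLen] at hb
    simp only [Finset.mem_sigma, Finset.mem_range]
    exact ⟨by omega, hb⟩
  · rintro ⟨j, i⟩ hb
    simp only [Finset.mem_sigma, Finset.mem_range] at hb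
    rw [YoungDiagram.mem_cells, YoungDiagram.mem_iff_lt_colLen]
    exact hb.2
  · intros; rfl
  · intros; rfl
  · intros; rfl

theorem colLen_eq_zero {lam : YoungDiagram} {j : ℕ} (hj : lam.rowLen 0 ≤ j) :
    lam.colLen j = 0 := by
  by_contra h
  have h1 : (0, j) ∈ lam := YoungDiagram.mem_iff_lt_colLen.2 (Nat.pos_of_ne_zero h)
  rw [YoungDiagram.mem_iff_lt_rowLen] at h1
  omega

open Classical in
theorem chargeProfile_apply (lam : YoungDiagram) (m : ℤ) :
    chargeProfile lam m = (if m ∈ maya lam then 1 else 0) - (if m < 0 then 1 else 0) := by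
  -- the columns from `J` on contribute nothing, and `m` is not the position of any of them
  set J := max (lam.rowLen 0) ((-m).toNat + 1) with hJ
  have hcol : chargeProfile lam = ∑ j ∈ Finset.range J,
      (Finsupp.single ((lam.colLen j : ℤ) - j - 1) 1 - Finsupp.single (-(j : ℤ) - 1) 1) := by
    rw [chargeProfile, sum_cells_eq_sum_columns lam (le_max_left _ _)]
    refine Finset.sum_congr rfl fun j _ => ?_
    have h := Finset.sum_range_sub
      (fun i : ℕ => (Finsupp.single ((i : ℤ) - j - 1) 1 : ℤ →₀ ℤ)) (lam.colLen j)
    rw [Nat.cast_zero, zero_sub] at h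
    rw [← h]
    refine Finset.sum_congr rfl fun i _ => ?_
    rw [content, Nat.cast_succ]
    congr 2
    ring
  rw [hcol, Finset.sum_sub_distrib, Finsupp.sub_apply, Finsupp.finsetSum_apply,
    Finsupp.finsetSum_apply]
  have hmono : ∀ a b : ℕ, (lam.colLen a : ℤ) - a - 1 = (lam.colLen b : ℤ) - b - 1 → a = b := by
    intro a b h
    rcases le_total a b with h' | h' <;> have := lam.colLen_anti _ _ h' <;> omega
  congr 1
  · by_cases hm : m ∈ maya lam
    · obtain ⟨j, hj⟩ := hm
      simp only at hj
      rw [if_pos ⟨j, hj⟩, Finset.sum_eq_single j]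
      · rw [Finsupp.single_apply, if_pos hj]
      · intro b _ hb
        rw [Finsupp.single_apply, if_neg fun h => hb (hmono _ _ (h.trans hj.symm))]
      · intro h
        exfalso
        rw [Finset.mem_range, not_lt] at h
        rw [colLen_eq_zero (le_trans (le_max_left _ _) h)] at hj
        have := le_trans (le_max_right _ _) h
        omega
    · rw [if_neg hm]
      refine Finset.sum_eq_zero fun j _ => ?_
      rw [Finsupp.single_apply, if_neg fun h => hm ⟨j, h⟩]
  · by_cases hm : m < 0
    · rw [if_pos hm, Finset.sum_eq_single (-m - 1).toNat]
      · rw [Finsupp.single_apply, if_pos (by omega)]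
      · intro b _ hb
        rw [Finsupp.single_apply, if_neg (by omega)]
      · intro h
        rw [Finset.mem_range, not_lt] at h
        have := le_trans (le_max_right _ _) h
        omega
    · rw [if_neg hm]
      refine Finset.sum_eq_zero fun j _ => ?_
      rw [Finsupp.single_apply, if_neg (by omega)]

theorem stepProfile_apply (p m : ℤ) :
    stepProfile p m = (if m < p then 1 else 0) - (if m < 0 then 1 else 0) := by
  rw [stepProfile, Finsupp.sub_apply, Finsupp.finsetSum_apply, Finsupp.finsetSum_apply]
  simp only [Finsupp.single_apply, Finset.sum_ite_eq', Finset.mem_Ico]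
  split_ifs <;> omega

theorem stepProfile_succ (p : ℤ) : stepProfile (p + 1) = stepProfile p + Finsupp.single p 1 := by
  ext m
  rw [Finsupp.add_apply, stepProfile_apply, stepProfile_apply, Finsupp.single_apply]
  split_ifs <;> omega

theorem stepProfile_zero : stepProfile 0 = 0 := by
  simp [stepProfile]

section Pairing

variable {A : Type*} [AddCommGroup A]

/-- A telescoping sum. -/
theorem linearCombination_stepProfile (H : ℤ → A) (p : ℤ) :
    Finsupp.linearCombination ℤ (fun m => H (m + 1) - H m) (stepProfile p) = H p - H 0 := by
  induction p using Int.induction_on with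
  | zero => rw [stepProfile_zero, map_zero, sub_self]
  | succ i ih =>
    rw [stepProfile_succ, map_add, ih, Finsupp.linearCombination_single, one_smul]
    abel
  | pred i ih =>
    have h := stepProfile_succ (-(i : ℤ) - 1)
    rw [sub_add_cancel] at h
    rw [h, map_add, Finsupp.linearCombination_single, one_smul, sub_add_cancel] at ih
    rw [← eq_sub_iff_add_eq] at ih
    rw [ih]
    abel

theorem linearCombination_chargeProfile (G : ℤ → A) (lam : YoungDiagram) :
    Finsupp.linearCombination ℤ G (chargeProfile lam) =
      ∑ b ∈ lam.cells, (G (content b) - G (content b - 1)) := by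
  rw [chargeProfile, map_sum]
  refine Finset.sum_congr rfl fun b _ => ?_
  rw [map_sub, Finsupp.linearCombination_single, Finsupp.linearCombination_single, one_smul,
    one_smul]

theorem linearCombination_filter (G : ℤ → A) (P : ℤ → Prop) [DecidablePred P] (l : ℤ →₀ ℤ) :
    Finsupp.linearCombination ℤ G (l.filter P) =
      Finsupp.linearCombination ℤ (fun m => if P m then G m else 0) l := by
  induction l using Finsupp.induction_linear with
  | zero => rw [Finsupp.filter_zero, map_zero, map_zero]
  | add f g hf hg => rw [Finsupp.filter_add, map_add, map_add, hf, hg]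
  | single a b =>
    rw [Finsupp.linearCombination_single]
    by_cases h : P a
    · rw [Finsupp.filter_single_of_pos _ h, Finsupp.linearCombination_single, if_pos h]
    · rw [Finsupp.filter_single_of_neg _ h, map_zero, if_neg h, smul_zero]

end Pairing

theorem color_eq_content (N : ℕ) (b : ℕ × ℕ) : color N b = ((content b : ℤ) : ZMod N) := by
  simp [color, content]

theorem cast_content_sub_one_eq_iff (N : ℕ) (b : ℕ × ℕ) (d : ZMod N) :
    (((content b - 1 : ℤ)) : ZMod N) = d ↔ color N b = d + 1 := by
  rw [color_eq_content, Int.cast_sub, Int.cast_one, sub_eq_iff_eq_add]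

open Classical in
/-- The shift `p_d` is minus the charge of the subsector of colour `d`. -/
theorem shift_eq (N : ℕ) (lam : YoungDiagram) (d : ZMod N) :
    shift N lam d = -Finsupp.linearCombination ℤ (fun _ : ℤ => (1 : ℤ))
      ((chargeProfile lam).filter fun m : ℤ => (m : ZMod N) = d) := by
  have hh : {m : ℤ | m < 0 ∧ m ∉ maya lam ∧ (m : ZMod N) = d} =
      (((chargeProfile lam).support.filter fun m => (m : ZMod N) = d ∧ m < 0 : Finset ℤ) :
        Set ℤ) := by
    ext m
    rw [Finset.coe_filter, Set.mem_ofPred_eq, Set.mem_ofPred_eq, Finsupp.mem_support_iff,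
      chargeProfile_apply]
    by_cases h1 : m < 0 <;> by_cases h2 : m ∈ maya lam <;> simp [h1, h2]
  have he : {m : ℤ | 0 ≤ m ∧ m ∈ maya lam ∧ (m : ZMod N) = d} =
      (((chargeProfile lam).support.filter fun m => (m : ZMod N) = d ∧ ¬ m < 0 : Finset ℤ) :
        Set ℤ) := by
    ext m
    rw [Finset.coe_filter, Set.mem_ofPred_eq, Set.mem_ofPred_eq, Finsupp.mem_support_iff,
      chargeProfile_apply, ← not_lt]
    by_cases h1 : m < 0 <;> by_cases h2 : m ∈ maya lam <;> simp [h1, h2]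
  rw [shift, hh, he, Set.ncard_coe_finset, Set.ncard_coe_finset, linearCombination_filter,
    Finsupp.linearCombination_apply, Finsupp.sum]
  simp only [smul_eq_mul, mul_ite, mul_one, mul_zero]
  rw [← Finset.sum_filter, ← Finset.sum_filter_add_sum_filter_not _ (fun m => m < 0),
    Finset.filter_filter, Finset.filter_filter, Finset.sum_congr rfl (g := fun _ => (-1 : ℤ)),
    Finset.sum_congr (s₂ := {m ∈ (chargeProfile lam).support |
      ((m : ℤ) : ZMod N) = d ∧ ¬ m < 0}) rfl (g := fun _ => (1 : ℤ))]
  · simp only [Finset.sum_const, nsmul_eq_mul]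
    ring
  · intro m hm
    rw [Finset.mem_filter, Finsupp.mem_support_iff] at hm
    have h := hm.1
    rw [chargeProfile_apply, if_neg hm.2.2] at h ⊢
    split_ifs at h ⊢ <;> simp_all
  · intro m hm
    rw [Finset.mem_filter, Finsupp.mem_support_iff] at hm
    have h := hm.1
    rw [chargeProfile_apply, if_pos hm.2.2] at h ⊢
    split_ifs at h ⊢ <;> simp_all

theorem sum_shift (N : ℕ) [NeZero N] (lam : YoungDiagram) : ∑ d : ZMod N, shift N lam d = 0 := by
  classical
  simp only [shift_eq, linearCombination_filter, Finset.sum_neg_distrib,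
    linearCombination_chargeProfile]
  rw [Finset.sum_comm, neg_eq_zero]
  refine Finset.sum_eq_zero fun b _ => ?_
  rw [Finset.sum_sub_distrib]
  simp

/-- The Young diagram with given column lengths. -/
def ofColLen (L : ℕ → ℕ) (hL : Antitone L) (J : ℕ) : YoungDiagram where
  cells := (Finset.range (L 0) ×ˢ Finset.range J).filter fun b => b.1 < L b.2
  isLowerSet := by
    rintro ⟨i, j⟩ ⟨i', j'⟩ ⟨hi, hj⟩ h
    simp only at hi hj
    simp only [Finset.coe_filter, Finset.mem_product, Finset.mem_range, Set.mem_ofPred_eq] at h ⊢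
    have := hL hj
    omega

theorem colLen_ofColLen {L : ℕ → ℕ} (hL : Antitone L) {J : ℕ} (hJ : L J = 0) (j : ℕ) :
    (ofColLen L hL J).colLen j = L j := by
  have h : ∀ i, i < (ofColLen L hL J).colLen j ↔ i < L j := by
    intro i
    rw [← YoungDiagram.mem_iff_lt_colLen, ← YoungDiagram.mem_cells]
    simp only [ofColLen, Finset.mem_filter, Finset.mem_product, Finset.mem_range]
    refine ⟨fun h => h.2, fun h => ⟨⟨lt_of_lt_of_le h (hL (Nat.zero_le j)), ?_⟩, h⟩⟩
    by_contra hj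
    have := hL (not_lt.1 hj)
    omega
  exact eq_of_forall_lt_iff h

open Classical in
/-- Every set of integers that differs from `{m : m < 0}` by equal finite numbers of electrons and
holes is the Maya diagram of a Young diagram. -/
theorem exists_maya_eq {S : Set ℤ} {T : ℤ →₀ ℤ}
    (hT : ∀ m, T m = (if m ∈ S then 1 else 0) - (if m < 0 then 1 else 0))
    (h0 : Finsupp.linearCombination ℤ (fun _ : ℤ => (1 : ℤ)) T = 0) :
    ∃ μ : YoungDiagram, maya μ = S := by
  obtain ⟨B, hB⟩ : ∃ B : ℕ, ∀ m : ℤ, T m ≠ 0 → -(B : ℤ) ≤ m ∧ m < B := by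
    refine ⟨∑ m ∈ T.support, (m.natAbs + 1), fun m hm => ?_⟩
    have := Finset.single_le_sum (f := fun m : ℤ => m.natAbs + 1) (fun _ _ => Nat.zero_le _)
      (Finsupp.mem_support_iff.2 hm)
    omega
  have hlow : ∀ m : ℤ, m < -(B : ℤ) → m ∈ S := by
    intro m hm
    by_contra hmS
    have h1 : T m ≠ 0 := by rw [hT, if_neg hmS, if_pos (by omega)]; norm_num
    have := hB m h1
    omega
  have hhigh : ∀ m ∈ S, m < (B : ℤ) := by
    intro m hmS
    by_contra hm
    have h1 : T m ≠ 0 := by rw [hT, if_pos hmS, if_neg (by omega)]; norm_num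
    have := hB m h1
    omega
  -- `K` is `S`, read downwards from its upper bound
  set K : ℕ → Prop := fun k => (B : ℤ) - 1 - k ∈ S with hK
  have hKlarge : ∀ k, 2 * B ≤ k → K k := fun k hk => hlow _ (by omega)
  have hinf : (Set.ofPred K).Infinite := Set.infinite_of_injective_forall_mem
    (f := fun k => k + 2 * B) (fun a b h => by simpa using h) fun k => hKlarge _ (by omega)
  -- `S` has as many elements above `-B` as the vacuum, so deep positions keep their vacuum
  -- numbering
  have hcount : ∀ t, Nat.count K (2 * B + t) = B + t := by
    intro t
    induction t with
    | zero =>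
      rw [Finsupp.linearCombination_apply, Finsupp.sum,
        Finset.sum_subset (s₂ := Finset.Ico (-(B : ℤ)) B) (fun m hm => by
          rw [Finset.mem_Ico]; exact hB m (Finsupp.mem_support_iff.1 hm))
          (fun m _ hm => by rw [Finsupp.notMem_support_iff.1 hm, zero_smul]),
        Finset.sum_nbij' (t := Finset.range (2 * B)) (fun m => ((B : ℤ) - 1 - m).toNat)
          (fun k => (B : ℤ) - 1 - k)
          (g := fun k => (if K k then 1 else 0) - (if k < B then 0 else 1))] at h0
      · rw [Finset.sum_sub_distrib] at h0
        have h1 : ∑ k ∈ Finset.range (2 * B), (if k < B then (0 : ℤ) else 1) = B := by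
          rw [two_mul, Finset.sum_range_add, Finset.sum_eq_zero, zero_add]
          · simp
          · intro k hk
            rw [if_pos (Finset.mem_range.1 hk)]
        rw [h1, Finset.sum_boole, ← Nat.count_eq_card_filter_range] at h0
        rw [add_zero, add_zero]
        omega
      · intro m hm
        rw [Finset.mem_Ico] at hm
        rw [Finset.mem_range]
        omega
      · intro k hk
        rw [Finset.mem_range] at hk
        rw [Finset.mem_Ico]
        omega
      · intro m hm
        rw [Finset.mem_Ico] at hm
        omega
      · intro k _
        omega
      · intro m hm
        rw [Finset.mem_Ico] at hm
        have h2 : (B : ℤ) - 1 - (((B : ℤ) - 1 - m).toNat : ℕ) = m := by omega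
        rw [smul_eq_mul, mul_one, hT, hK]
        simp only [h2]
        congr 1
        split_ifs <;> omega
    | succ t ih =>
      rw [← add_assoc, Nat.count_succ, ih, if_pos (hKlarge _ (by omega)), add_assoc]
  have hnth : ∀ t, Nat.nth K (B + t) = 2 * B + t := fun t => by
    rw [← hcount t, Nat.nth_count (hKlarge _ (by omega))]
  have hstep : ∀ j, Nat.nth K j + 1 ≤ Nat.nth K (j + 1) := fun j =>
    Nat.nth_strictMono hinf (Nat.lt_succ_self j)
  have hle : ∀ j, Nat.nth K j ≤ B + j := by
    intro j
    by_contra hcon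
    have hgrow : ∀ t, Nat.nth K j + t ≤ Nat.nth K (j + t) := by
      intro t
      induction t with
      | zero => simp
      | succ t ih => have := hstep (j + t); rw [← add_assoc, ← add_assoc]; omega
    have h1 := hgrow B
    rw [add_comm j B, hnth] at h1
    omega
  have hanti : Antitone fun j => B + j - Nat.nth K j := antitone_nat_of_succ_le fun j => by
    have := hstep j
    omega
  refine ⟨ofColLen _ hanti B, ?_⟩
  have h0' : B + B - Nat.nth K B = 0 := by
    have := hnth 0
    rw [add_zero] at this
    omega
  ext m
  constructor
  · rintro ⟨j, rfl⟩
    simp only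
    rw [colLen_ofColLen hanti h0']
    have h1 : K (Nat.nth K j) := Nat.nth_mem_of_infinite hinf j
    have h2 := hle j
    have h3 : ((B + j - Nat.nth K j : ℕ) : ℤ) - j - 1 = (B : ℤ) - 1 - Nat.nth K j := by omega
    rw [h3]
    exact h1
  · intro hm
    have h1 := hhigh m hm
    have h2 : K ((B : ℤ) - 1 - m).toNat := by
      rw [hK]
      simp only
      rwa [show (B : ℤ) - 1 - (((B : ℤ) - 1 - m).toNat : ℕ) = m by omega]
    refine ⟨Nat.count K ((B : ℤ) - 1 - m).toNat, ?_⟩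
    simp only
    rw [colLen_ofColLen hanti h0']
    have h3 := Nat.nth_count h2
    have h4 := hle (Nat.count K ((B : ℤ) - 1 - m).toNat)
    omega

section Quotient

variable {N : ℕ} [NeZero N]

theorem cast_eq_iff_exists (d : ZMod N) (p n : ℤ) :
    (n : ZMod N) = d ↔ ∃ m : ℤ, (N : ℤ) * (m - p) + (d.val : ℤ) = n := by
  constructor
  · intro h
    have h1 : ((n - (d.val : ℤ) : ℤ) : ZMod N) = 0 := by
      rw [Int.cast_sub, h, Int.cast_natCast, ZMod.natCast_zmod_val, sub_self]
    obtain ⟨k, hk⟩ := (ZMod.intCast_zmod_eq_zero_iff_dvd _ N).1 h1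
    exact ⟨k + p, by rw [add_sub_cancel_right, ← hk]; ring⟩
  · rintro ⟨m, rfl⟩
    simp

theorem quotientMap_injective (p d : ℤ) :
    Function.Injective fun m : ℤ => (N : ℤ) * (m - p) + d := by
  intro a b h
  simpa [NeZero.ne N] using h

theorem quotientMap_neg_iff (d : ZMod N) (p m : ℤ) :
    (N : ℤ) * (m - p) + (d.val : ℤ) < 0 ↔ m < p := by
  have h1 : (d.val : ℤ) < N := by exact_mod_cast ZMod.val_lt d
  have h2 : (0 : ℤ) ≤ d.val := Int.natCast_nonneg _
  constructor
  · intro h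
    by_contra hm
    have : 0 ≤ (N : ℤ) * (m - p) := mul_nonneg (by omega) (by omega)
    omega
  · intro h
    have : (N : ℤ) * (m - p) ≤ N * (-1) := mul_le_mul_of_nonneg_left (by omega) (by omega)
    omega

/-- The `N`-quotients of a Young diagram exist. -/
theorem exists_isQuotient (lam : YoungDiagram) (d : ZMod N) :
    ∃ μ : YoungDiagram, IsQuotient N lam d μ := by
  classical
  set p := shift N lam d with hp
  set φ : ℤ → ℤ := fun m => (N : ℤ) * (m - p) + (d.val : ℤ) with hφ
  have hinj : Function.Injective φ := quotientMap_injective p _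
  set T₀ := (chargeProfile lam).comapDomain φ hinj.injOn with hT₀
  have hfilter : (chargeProfile lam).filter (fun m : ℤ => (m : ZMod N) = d) = T₀.mapDomain φ := by
    ext n
    by_cases h : (n : ZMod N) = d
    · obtain ⟨m, rfl⟩ := (cast_eq_iff_exists d p n).1 h
      rw [Finsupp.filter_apply_pos (fun m : ℤ => (m : ZMod N) = d) _ h]
      exact (Finsupp.mapDomain_apply hinj T₀ m).symm
    · rw [Finsupp.filter_apply_neg (fun m : ℤ => (m : ZMod N) = d) _ h,
        Finsupp.mapDomain_of_notMem_range]
      rintro ⟨m, hm⟩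
      exact h ((cast_eq_iff_exists d p n).2 ⟨m, hm⟩)
  refine exists_maya_eq (T := T₀ + stepProfile p) (fun m => ?_) ?_
  · rw [Finsupp.add_apply, Finsupp.comapDomain_apply, chargeProfile_apply, stepProfile_apply]
    simp only [hφ, quotientMap_neg_iff, Set.mem_ofPred_eq]
    ring
  · have h1 := shift_eq N lam d
    rw [hfilter, Finsupp.linearCombination_mapDomain] at h1
    have h2 := linearCombination_stepProfile (fun m : ℤ => m) p
    simp only [add_sub_cancel_left, sub_zero] at h2
    rw [map_add, h2]
    have h3 : ((fun _ : ℤ => (1 : ℤ)) ∘ φ) = fun _ => 1 := rfl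
    rw [h3, ← hp] at h1
    omega

/-- Sums over the boundary of `lam` in colour `d`, expressed through the `d`-th quotient: both sides
compute the pairing of `G` with the subsector of colour `d` of the Maya diagram. -/
theorem sum_cells_quotient {A : Type*} [AddCommGroup A] {lam μ : YoungDiagram} {d : ZMod N}
    (hμ : IsQuotient N lam d μ) (G : ℤ → A) :
    ∑ b ∈ lam.cells, ((if color N b = d then G (content b) else 0) -
        (if color N b = d + 1 then G (content b - 1) else 0)) =
      ∑ b ∈ μ.cells, (G ((N : ℤ) * (content b - shift N lam d) + (d.val : ℤ)) -
          G ((N : ℤ) * (content b - 1 - shift N lam d) + (d.val : ℤ))) -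
        Finsupp.linearCombination ℤ (fun m => G ((N : ℤ) * (m - shift N lam d) + (d.val : ℤ)))
          (stepProfile (shift N lam d)) := by
  classical
  set p := shift N lam d with hp
  set φ : ℤ → ℤ := fun m => (N : ℤ) * (m - p) + (d.val : ℤ) with hφ
  have hinj : Function.Injective φ := quotientMap_injective p _
  have hfilter : (chargeProfile lam).filter (fun m : ℤ => (m : ZMod N) = d) =
      (chargeProfile μ - stepProfile p).mapDomain φ := by
    ext n
    by_cases h : (n : ZMod N) = d
    · obtain ⟨m, rfl⟩ := (cast_eq_iff_exists d p n).1 h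
      rw [Finsupp.filter_apply_pos (fun m : ℤ => (m : ZMod N) = d) _ h]
      refine Eq.trans ?_ (Finsupp.mapDomain_apply hinj _ m).symm
      rw [Finsupp.sub_apply, chargeProfile_apply, chargeProfile_apply, stepProfile_apply,
        show maya μ = {m : ℤ | (N : ℤ) * (m - p) + (d.val : ℤ) ∈ maya lam} from hμ]
      simp only [quotientMap_neg_iff, Set.mem_ofPred_eq]
      ring
    · rw [Finsupp.filter_apply_neg (fun m : ℤ => (m : ZMod N) = d) _ h,
        Finsupp.mapDomain_of_notMem_range]
      rintro ⟨m, hm⟩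
      exact h ((cast_eq_iff_exists d p n).2 ⟨m, hm⟩)
  have h1 := linearCombination_filter G (fun m => (m : ZMod N) = d) (chargeProfile lam)
  rw [hfilter, Finsupp.linearCombination_mapDomain, map_sub, linearCombination_chargeProfile,
    linearCombination_chargeProfile] at h1
  simp only [cast_content_sub_one_eq_iff, ← color_eq_content] at h1
  rw [← h1]
  rfl

end Quotient

open Complex

/-! ### The Heisenberg algebra in the unrefined limit -/

theorem qInt_zero (n : ℤ) : qInt 0 n = n := by
  simp only [qInt, mul_zero, exp_zero, Finset.sum_const, Finset.card_range, nsmul_eq_mul, mul_one]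
  rw [← Int.cast_natCast (R := ℂ) n.natAbs, ← Int.cast_mul, Int.sign_mul_natAbs]

theorem kron_comm {N : ℕ} (i j : ZMod N) : kron i j = kron j i := by
  simp only [kron, eq_comm]

theorem kron_sub_one {N : ℕ} (i j : ZMod N) : kron (i - 1) j = kron (j + 1) i := by
  rw [kron, kron]
  exact if_congr (by rw [sub_eq_iff_eq_add, eq_comm]) rfl rfl

theorem cartan_symm {N : ℕ} (i j : ZMod N) : cartan i j = cartan j i := by
  rw [cartan, cartan, kron_comm i j, kron_sub_one i j, kron_sub_one j i]
  ring

theorem skew_symm {N : ℕ} (i j : ZMod N) : skew i j = -skew j i := by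
  rw [skew, skew, kron_sub_one i j, kron_sub_one j i]
  ring

/-- The structure constant of `[H_{c,r}, H_{e,-r}]` at `𝔮 = 1`. -/
noncomputable def pairingCoeff {N : ℕ} (τ : ℂ) (c e : ZMod N) (r : ℤ) : ℂ :=
  r * cartan c e * exp (-((r * skew c e : ℤ) : ℂ) * τ)

theorem pairingCoeff_neg {N : ℕ} (τ : ℂ) (c e : ZMod N) (r : ℤ) :
    pairingCoeff τ e c (-r) = -pairingCoeff τ c e r := by
  rw [pairingCoeff, pairingCoeff, cartan_symm e c, skew_symm e c]
  push_cast
  ring_nf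

theorem deformedCartan_zero {N : ℕ} (τ : ℂ) (c e : ZMod N) {r : ℤ} (hr : r ≠ 0) :
    deformedCartan N 0 τ r c e = cartan c e * exp (-((r * skew c e : ℤ) : ℂ) * τ) := by
  have h : (r : ℂ) ≠ 0 := Int.cast_ne_zero.2 hr
  rw [deformedCartan, Matrix.of_apply, qInt_zero, qInt_zero]
  push_cast
  rw [mul_div_cancel_left₀ _ h]

section

variable {N : ℕ} [NeZero N]

theorem oscBoson_zero (ε τ : ℂ) (c : ZMod N) : oscBoson N ε τ c 0 = 0 := rfl

theorem oscBoson_neg (ε τ : ℂ) (c : ZMod N) (k : ℕ) :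
    oscBoson N ε τ c (-((k : ℤ) + 1)) = LinearMap.mulLeft ℂ (MvPolynomial.X (c, k)) := by
  rw [show -((k : ℤ) + 1) = Int.negSucc k from (Int.negSucc_eq k).symm]
  rfl

theorem oscBoson_pos (τ : ℂ) (c : ZMod N) (k : ℕ) :
    oscBoson N 0 τ c ((k : ℤ) + 1) = ∑ e : ZMod N,
      pairingCoeff τ c e ((k : ℤ) + 1) • (MvPolynomial.pderiv (e, k)).toLinearMap := by
  change (∑ e : ZMod N, (qInt 0 (k + 1) ^ 2 / ((k : ℂ) + 1) * deformedCartan N 0 τ (k + 1) c e) •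
    (MvPolynomial.pderiv (e, k)).toLinearMap : Module.End ℂ (Osc N)) = _
  refine Finset.sum_congr rfl fun e _ => ?_
  rw [deformedCartan_zero _ _ _ (by omega), qInt_zero, pairingCoeff]
  have h : (k : ℂ) + 1 ≠ 0 := by exact_mod_cast Nat.succ_ne_zero k
  push_cast
  congr 1
  field_simp

theorem pderiv_pderiv {σ : Type*} (i j : σ) (p : MvPolynomial σ ℂ) :
    MvPolynomial.pderiv i (MvPolynomial.pderiv j p) =
      MvPolynomial.pderiv j (MvPolynomial.pderiv i p) := by
  classical
  have h : ⁅MvPolynomial.pderiv (R := ℂ) i, MvPolynomial.pderiv (R := ℂ) j⁆ = 0 := by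
    refine MvPolynomial.derivation_ext fun l => ?_
    rw [Derivation.commutator_apply, MvPolynomial.pderiv_X, MvPolynomial.pderiv_X,
      Pi.single_apply, Pi.single_apply]
    split_ifs <;> simp
  have h1 := congrArg
    (fun D : Derivation ℂ (MvPolynomial σ ℂ) (MvPolynomial σ ℂ) => D p) h
  simpa [Derivation.commutator_apply, sub_eq_zero] using h1

/-- The annihilation-creation commutator. -/
theorem oscBoson_pos_neg (τ : ℂ) (c e : ZMod N) (k j : ℕ) :
    oscBoson N 0 τ c ((k : ℤ) + 1) * oscBoson N 0 τ e (-((j : ℤ) + 1)) -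
      oscBoson N 0 τ e (-((j : ℤ) + 1)) * oscBoson N 0 τ c ((k : ℤ) + 1) =
    (if k = j then pairingCoeff τ c e ((k : ℤ) + 1) else 0) • 1 := by
  classical
  rw [oscBoson_pos, oscBoson_neg]
  refine LinearMap.ext fun p => ?_
  simp only [LinearMap.sub_apply, Module.End.mul_apply, LinearMap.mulLeft_apply,
    LinearMap.sum_apply, LinearMap.smul_apply, Derivation.coeFn_coe, Derivation.leibniz,
    MvPolynomial.pderiv_X, Pi.single_apply, Module.End.one_apply, smul_eq_mul, Finset.mul_sum,
    ← Finset.sum_sub_distrib]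
  rw [Finset.sum_eq_single e]
  · by_cases h : k = j
    · subst h
      simp only [if_true, mul_one, smul_add, mul_smul_comm]
      abel
    · rw [if_neg (by simpa using Ne.symm h), if_neg h, mul_zero, add_zero, zero_smul,
        mul_smul_comm, sub_self]
  · intro b _ hb
    rw [if_neg (by simpa using fun h : e = b => absurd h.symm hb), mul_zero, add_zero,
      mul_smul_comm, sub_self]
  · simp

theorem oscBoson_commutator (τ : ℂ) (c e : ZMod N) (r s : ℤ) :
    oscBoson N 0 τ c r * oscBoson N 0 τ e s - oscBoson N 0 τ e s * oscBoson N 0 τ c r =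
      (if r + s = 0 then pairingCoeff τ c e r else 0) • 1 := by
  rcases lt_trichotomy r 0 with hr | rfl | hr
  · obtain ⟨k, rfl⟩ : ∃ k : ℕ, r = -((k : ℤ) + 1) := ⟨(-r - 1).toNat, by omega⟩
    rcases lt_trichotomy s 0 with hs | rfl | hs
    · obtain ⟨j, rfl⟩ : ∃ j : ℕ, s = -((j : ℤ) + 1) := ⟨(-s - 1).toNat, by omega⟩
      rw [if_neg (by omega), zero_smul, oscBoson_neg, oscBoson_neg, sub_eq_zero]
      refine LinearMap.ext fun p => ?_
      simp only [Module.End.mul_apply, LinearMap.mulLeft_apply]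
      ring
    · rw [if_neg (by omega), oscBoson_zero]
      simp
    · obtain ⟨j, rfl⟩ : ∃ j : ℕ, s = (j : ℤ) + 1 := ⟨(s - 1).toNat, by omega⟩
      rw [← neg_sub, oscBoson_pos_neg]
      refine (neg_smul _ _).symm.trans ?_
      congr 1
      by_cases h : j = k
      · subst h
        rw [if_pos rfl, if_pos (by omega), pairingCoeff_neg]
      · rw [if_neg h, if_neg (by omega), neg_zero]
  · rw [oscBoson_zero]
    simp [pairingCoeff]
  · obtain ⟨k, rfl⟩ : ∃ k : ℕ, r = (k : ℤ) + 1 := ⟨(r - 1).toNat, by omega⟩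
    rcases lt_trichotomy s 0 with hs | rfl | hs
    · obtain ⟨j, rfl⟩ : ∃ j : ℕ, s = -((j : ℤ) + 1) := ⟨(-s - 1).toNat, by omega⟩
      rw [oscBoson_pos_neg]
      congr 1
      exact if_congr (by omega) rfl rfl
    · rw [if_neg (by omega), oscBoson_zero]
      simp
    · obtain ⟨j, rfl⟩ : ∃ j : ℕ, s = (j : ℤ) + 1 := ⟨(s - 1).toNat, by omega⟩
      rw [if_neg (by omega), zero_smul, oscBoson_pos, oscBoson_pos, sub_eq_zero]
      refine LinearMap.ext fun p => ?_
      simp only [Module.End.mul_apply, LinearMap.sum_apply, LinearMap.smul_apply,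
        Derivation.coeFn_coe, map_sum, Derivation.map_smul]
      rw [Finset.sum_comm]
      refine Finset.sum_congr rfl fun a _ => Finset.sum_congr rfl fun b _ => ?_
      rw [pderiv_pderiv, smul_comm]

theorem boson_apply (ε τ : ℂ) (c : ZMod N) (m : ℤ) (f : Fock N) (x : weightLattice N) :
    boson N ε τ c m f x = oscBoson N ε τ c m (f x) := by
  rw [boson, Finsupp.mapRange.linearMap_apply, Finsupp.mapRange_apply]

theorem boson_zero (ε τ : ℂ) (c : ZMod N) : boson N ε τ c 0 = 0 := by
  refine LinearMap.ext fun f => Finsupp.ext fun x => ?_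
  rw [boson_apply, oscBoson_zero]
  rfl

theorem boson_commutator (τ : ℂ) (c e : ZMod N) (r s : ℤ) :
    boson N 0 τ c r * boson N 0 τ e s - boson N 0 τ e s * boson N 0 τ c r =
      (if r + s = 0 then pairingCoeff τ c e r else 0) • 1 := by
  refine LinearMap.ext fun f => Finsupp.ext fun x => ?_
  simp only [LinearMap.sub_apply, Module.End.mul_apply, Finsupp.sub_apply, boson_apply,
    LinearMap.smul_apply, Module.End.one_apply, Finsupp.smul_apply]
  exact LinearMap.congr_fun (oscBoson_commutator τ c e r s) (f x)

end

/-! ### Normal ordering on the Fock space -/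

section

variable {N : ℕ}

/-- The span of the vectors of degree at most `D`, where the creation operator `H_{c,-r}` has degree
`r`. -/
noncomputable def degreeLE (N : ℕ) (D : ℤ) : Submodule ℂ (Fock N) :=
  Submodule.span ℂ {f | ∃ (x : weightLattice N) (s : ZMod N × ℕ →₀ ℕ) (a : ℂ),
    (Finsupp.weight (fun i : ZMod N × ℕ => i.2 + 1) s : ℤ) ≤ D ∧
      f = Finsupp.single x (MvPolynomial.monomial s a)}

theorem degreeLE_mono {D E : ℤ} (h : D ≤ E) : degreeLE N D ≤ degreeLE N E := by
  refine Submodule.span_mono ?_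
  rintro f ⟨x, s, a, hs, rfl⟩
  exact ⟨x, s, a, hs.trans h, rfl⟩

theorem exists_mem_degreeLE (f : Fock N) : ∃ D, f ∈ degreeLE N D := by
  have hadd : ∀ f g : Fock N, (∃ D, f ∈ degreeLE N D) → (∃ D, g ∈ degreeLE N D) →
      ∃ D, f + g ∈ degreeLE N D := by
    rintro f g ⟨D, hD⟩ ⟨E, hE⟩
    exact ⟨max D E, Submodule.add_mem _ (degreeLE_mono (le_max_left _ _) hD)
      (degreeLE_mono (le_max_right _ _) hE)⟩
  induction f using Finsupp.induction_linear with
  | zero => exact ⟨0, Submodule.zero_mem _⟩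
  | add f g hf hg => exact hadd f g hf hg
  | single x p =>
    induction p using MvPolynomial.induction_on' with
    | monomial s a => exact ⟨_, Submodule.subset_span ⟨x, s, a, le_rfl, rfl⟩⟩
    | add p q hp hq =>
      rw [Finsupp.single_add]
      exact hadd _ _ hp hq

theorem degreeLE_neg {D : ℤ} (hD : D < 0) : degreeLE N D = ⊥ := by
  rw [degreeLE, Submodule.span_eq_bot]
  rintro f ⟨x, s, a, hs, rfl⟩
  omega

variable [NeZero N]

theorem boson_mem_degreeLE (τ : ℂ) (c : ZMod N) {r : ℕ} (hr : 0 < r) {D : ℤ} {f : Fock N}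
    (hf : f ∈ degreeLE N D) : boson N 0 τ c r f ∈ degreeLE N (D - r) := by
  obtain ⟨k, rfl⟩ : ∃ k, r = k + 1 := ⟨r - 1, by omega⟩
  have hle : degreeLE N D ≤ (degreeLE N (D - (k + 1 : ℕ))).comap (boson N 0 τ c (k + 1 : ℕ)) := by
    rw [degreeLE, Submodule.span_le]
    rintro f ⟨x, s, a, hs, rfl⟩
    rw [SetLike.mem_coe, Submodule.mem_comap, boson, Finsupp.mapRange.linearMap_apply,
      Finsupp.mapRange_single, Nat.cast_succ, oscBoson_pos, LinearMap.sum_apply,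
      Finsupp.single_finsetSum]
    refine Submodule.sum_mem _ fun e _ => ?_
    rw [LinearMap.smul_apply, ← Finsupp.smul_single, Derivation.coeFn_coe,
      MvPolynomial.pderiv_monomial]
    refine Submodule.smul_mem _ _ ?_
    by_cases h0 : s (e, k) = 0
    · rw [h0, Nat.cast_zero, mul_zero, MvPolynomial.monomial_zero, Finsupp.single_zero]
      exact Submodule.zero_mem _
    · refine Submodule.subset_span ⟨x, _, _, ?_, rfl⟩
      have h1 : s - Finsupp.single (e, k) 1 + Finsupp.single (e, k) 1 = s :=
        tsub_add_cancel_of_le (Finsupp.single_le_iff.2 (Nat.one_le_iff_ne_zero.2 h0))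
      have h2 := congrArg (Finsupp.weight (fun i : ZMod N × ℕ => i.2 + 1)) h1
      rw [map_add, Finsupp.weight_single, one_smul] at h2
      push_cast at *
      omega
  exact hle hf

theorem normalOrderable_of_bosons (τ : ℂ) {X : ℤ → Module.End ℂ (Fock N)} {a : ZMod N → ℤ → ℂ}
    (hX : ∀ m, X m = ∑ c, a c m • boson N 0 τ c m) : NormalOrderable X := by
  refine normalOrderable_of_filtration (degreeLE N) exists_mem_degreeLE (fun D => degreeLE_neg)
    fun r hr D f hf => ?_
  rw [hX, LinearMap.sum_apply]
  exact Submodule.sum_mem _ fun c _ => Submodule.smul_mem _ _ (boson_mem_degreeLE τ c hr hf)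

end

/-! ### The matrix `L` and the modified bosons -/

section

variable {N : ℕ}

theorem one_ne_zero_zmod (hN : 3 ≤ N) : (1 : ZMod N) ≠ 0 := by
  intro h
  have h1 : ((1 : ℕ) : ZMod N) = 0 := by rw [Nat.cast_one, h]
  have := Nat.le_of_dvd one_pos ((ZMod.natCast_eq_zero_iff _ _).1 h1)
  omega

theorem two_ne_zero_zmod (hN : 3 ≤ N) : (1 + 1 : ZMod N) ≠ 0 := by
  intro h
  have h1 : ((2 : ℕ) : ZMod N) = 0 := by
    rw [← h]
    norm_num
  have := Nat.le_of_dvd two_pos ((ZMod.natCast_eq_zero_iff _ _).1 h1)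
  omega

/-- The entries `a_{ce} x^{m_{ce}}`; the three neighbouring colours are distinct as `3 ≤ N`. -/
theorem cartan_mul_exp (hN : 3 ≤ N) (τ : ℂ) (r : ℤ) (c e : ZMod N) :
    (cartan c e : ℂ) * exp (-((r * skew c e : ℤ) : ℂ) * τ) =
      (if e = c then 2 else 0) - (if e = c - 1 then exp τ ^ (-r) else 0) -
        (if e = c + 1 then (exp τ ^ (-r))⁻¹ else 0) := by
  have h1 := one_ne_zero_zmod hN
  have h2 := two_ne_zero_zmod hN
  have h12 : c - 1 ≠ c + 1 := by
    intro h
    apply h2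
    rw [sub_eq_iff_eq_add, add_assoc] at h
    simpa using h
  have hx : ∀ n : ℤ, exp τ ^ n = exp (n * τ) := fun n => (exp_int_mul τ n).symm
  rw [← zpow_neg, neg_neg, hx, hx]
  by_cases ha : e = c
  · subst ha
    rw [if_pos rfl, if_neg (by simpa [eq_sub_iff_add_eq] using h1), if_neg (by simpa using h1)]
    simp [cartan, skew, kron, h1]
  · by_cases hb : e = c - 1
    · subst hb
      rw [if_neg ha, if_pos rfl, if_neg h12]
      simp [cartan, skew, kron, h12.symm, Ne.symm ha]
    · by_cases hc : e = c + 1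
      · subst hc
        rw [if_neg ha, if_neg hb, if_pos rfl]
        simp [cartan, skew, kron, h12, h1]
      · rw [if_neg ha, if_neg hb, if_neg hc]
        simp [cartan, kron, Ne.symm ha, Ne.symm hb, Ne.symm hc]

variable [NeZero N]

theorem matL_eq {x : ℂ} (c d : ZMod N) : matL N c d x = x ^ (d - c).val := by
  have h1 : ((d - c).val : ℤ) = ((d.val : ℤ) - c.val) % N := by
    rw [← ZMod.val_intCast]
    simp
  have h2 : ⌊((d.val : ℚ) - (c.val : ℚ)) / (N : ℚ)⌋ = ((d.val : ℤ) - c.val) / N := by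
    rw [← Rat.floor_intCast_div_natCast]
    push_cast
    rfl
  rw [matL, h2, ← zpow_natCast, h1, Int.emod_def]
  congr 1
  ring

/-- The first-order recursion in the colour satisfied by the entries of `L`. -/
theorem pow_val_sub {x : ℂ} (hx : x ≠ 0) (k : ZMod N) :
    x ^ k.val - x⁻¹ * x ^ (k + 1).val = if k + 1 = 0 then x⁻¹ * (x ^ N - 1) else 0 := by
  have hlt := ZMod.val_lt k
  have hval : ((k + 1).val : ℤ) = ((k.val : ℤ) + 1) % N := by
    rw [← ZMod.val_intCast]
    simp
  by_cases h : k.val + 1 = N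
  · have h0 : k + 1 = 0 := by
      rw [← ZMod.val_eq_zero]
      have h2 : ((k.val : ℤ) + 1) % N = 0 := by
        rw [show (k.val : ℤ) + 1 = N by exact_mod_cast h, Int.emod_self]
      omega
    have hxN : x ^ N = x ^ k.val * x := by rw [← pow_succ, h]
    rw [if_pos h0, h0, ZMod.val_zero, pow_zero, hxN]
    field_simp
  · have h1 : (k + 1).val = k.val + 1 := by
      rw [Int.emod_eq_of_lt (by omega) (by omega)] at hval
      omega
    rw [if_neg, h1, pow_succ]
    · field_simp
      ring
    · intro h0
      rw [h0, ZMod.val_zero] at h1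
      omega

/-- The matrix `L` diagonalizes the deformed Cartan matrix: `L(x)ᵀ C L(x⁻¹) = (1 - x^N)(1 - x^{-N})`
for `x = q₁^{-r}`. -/
theorem sum_matL_mul_cartan_mul_matL (hN : 3 ≤ N) (τ : ℂ) (r : ℤ) (d f : ZMod N) :
    ∑ c, ∑ e, (exp τ ^ (-r)) ^ (d - c).val * ((exp τ ^ (-r))⁻¹) ^ (f - e).val *
        ((cartan c e : ℂ) * exp (-((r * skew c e : ℤ) : ℂ) * τ)) =
      if d = f then ((exp τ ^ (-r)) ^ N - 1) * (((exp τ ^ (-r))⁻¹) ^ N - 1) else 0 := by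
  simp only [cartan_mul_exp hN]
  set x := exp τ ^ (-r) with hxdef
  have hx : x ≠ 0 := zpow_ne_zero _ (exp_ne_zero τ)
  have hy : x⁻¹ ≠ 0 := inv_ne_zero hx
  have hinner : ∀ c : ZMod N, ∑ e, x ^ (d - c).val * (x⁻¹) ^ (f - e).val *
      ((if e = c then 2 else 0) - (if e = c - 1 then x else 0) - (if e = c + 1 then x⁻¹ else 0)) =
      x ^ (d - c).val * (x⁻¹ ^ N - 1) *
        ((if c = f + 1 then x else 0) - (if c = f then 1 else 0)) := by
    intro c
    simp only [mul_sub, mul_ite, mul_zero, Finset.sum_sub_distrib, Finset.sum_ite_eq',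
      Finset.mem_univ, if_true]
    have h1 := pow_val_sub hy (f - c)
    have h2 := pow_val_sub hy (f - (c + 1))
    rw [show f - c + 1 = f - (c - 1) by ring, inv_inv] at h1
    rw [show f - (c + 1) + 1 = f - c by ring, inv_inv] at h2
    have h3 : (f - (c - 1) = 0) ↔ c = f + 1 := by
      rw [sub_eq_zero, eq_sub_iff_add_eq, eq_comm]
    have h4 : (f - c = 0) ↔ c = f := by rw [sub_eq_zero, eq_comm]
    rw [if_congr h3 rfl rfl] at h1
    rw [if_congr h4 rfl rfl] at h2
    have h5 : x * x⁻¹ = 1 := mul_inv_cancel₀ hx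
    split_ifs at h1 h2 ⊢ <;>
    first
    | linear_combination x ^ (d - c).val * h1 - x⁻¹ * x ^ (d - c).val * h2 -
        x ^ (d - c).val * x⁻¹ ^ (f - c).val * h5
    | linear_combination x ^ (d - c).val * h1 - x⁻¹ * x ^ (d - c).val * h2 +
        x ^ (d - c).val * (1 - x⁻¹ ^ N - x⁻¹ ^ (f - c).val) * h5
  rw [Finset.sum_congr rfl fun c _ => hinner c]
  simp only [mul_sub, mul_ite, mul_zero, Finset.sum_sub_distrib, Finset.sum_ite_eq',
    Finset.mem_univ, if_true, mul_one]
  have h1 := pow_val_sub hx (d - (f + 1))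
  rw [show d - (f + 1) + 1 = d - f by ring, if_congr sub_eq_zero rfl rfl] at h1
  have h5 : x * x⁻¹ = 1 := mul_inv_cancel₀ hx
  split_ifs at h1 ⊢
  · linear_combination x * (x⁻¹ ^ N - 1) * h1 +
      (x⁻¹ ^ N - 1) * (x ^ (d - f).val + x ^ N - 1) * h5
  · linear_combination x * (x⁻¹ ^ N - 1) * h1 + (x⁻¹ ^ N - 1) * x ^ (d - f).val * h5

theorem sum_smul_commutator {ι R : Type*} [Fintype ι] [Ring R] [Algebra ℂ R] (a b : ι → ℂ)
    (u v : ι → R) : (∑ c, a c • u c) * (∑ e, b e • v e) - (∑ e, b e • v e) * (∑ c, a c • u c) =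
      ∑ c, ∑ e, (a c * b e) • (u c * v e - v e * u c) := by
  rw [Finset.sum_mul_sum, Finset.sum_mul_sum,
    Finset.sum_comm (f := fun e c => (b e • v e) * (a c • u c)), ← Finset.sum_sub_distrib]
  refine Finset.sum_congr rfl fun c _ => ?_
  rw [← Finset.sum_sub_distrib]
  refine Finset.sum_congr rfl fun e _ => ?_
  rw [smul_mul_smul_comm, smul_mul_smul_comm, mul_comm (b e), ← smul_sub]

theorem bosonTilde_eq (τ : ℂ) (d : ZMod N) (m : ℤ) : bosonTilde N τ d m =
    ∑ c, (exp τ ^ (-m)) ^ (d - c).val • boson N 0 τ c m := by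
  simp only [bosonTilde, matL_eq]

theorem bosonTilde_commutator (hN : 3 ≤ N) (τ : ℂ) (d f : ZMod N) (r s : ℤ) :
    bosonTilde N τ d r * bosonTilde N τ f s - bosonTilde N τ f s * bosonTilde N τ d r =
      if d = f ∧ r + s = 0 then
        ((1 - exp τ ^ (r * (N : ℤ))) * (1 - exp τ ^ (-r * (N : ℤ))) * (r : ℂ)) •
          (1 : Module.End ℂ (Fock N))
      else 0 := by
  have h1 : bosonTilde N τ d r * bosonTilde N τ f s - bosonTilde N τ f s * bosonTilde N τ d r =
      (∑ c, ∑ e, (exp τ ^ (-r)) ^ (d - c).val * (exp τ ^ (-s)) ^ (f - e).val *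
        (if r + s = 0 then pairingCoeff τ c e r else 0)) • (1 : Module.End ℂ (Fock N)) := by
    rw [bosonTilde_eq, bosonTilde_eq]
    refine (sum_smul_commutator _ _ (fun c => boson N 0 τ c r) fun e => boson N 0 τ e s).trans ?_
    rw [Finset.sum_smul]
    refine Finset.sum_congr rfl fun c _ => ?_
    rw [Finset.sum_smul]
    refine Finset.sum_congr rfl fun e _ => ?_
    exact (congrArg (fun T : Module.End ℂ (Fock N) =>
      ((exp τ ^ (-r)) ^ (d - c).val * (exp τ ^ (-s)) ^ (f - e).val) • T)
      (boson_commutator τ c e r s)).trans (smul_smul _ _ _)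
  rw [h1]
  by_cases hrs : r + s = 0
  · have hs : s = -r := by omega
    subst hs
    have h2 : ∀ c e : ZMod N, (exp τ ^ (-r)) ^ (d - c).val * (exp τ ^ (-(-r))) ^ (f - e).val *
        (if r + -r = 0 then pairingCoeff τ c e r else 0) =
        r * ((exp τ ^ (-r)) ^ (d - c).val * ((exp τ ^ (-r))⁻¹) ^ (f - e).val *
        ((cartan c e : ℂ) * exp (-((r * skew c e : ℤ) : ℂ) * τ))) := by
      intro c e
      rw [if_pos hrs, pairingCoeff, zpow_neg _ (-r)]
      ring
    simp only [h2, ← Finset.mul_sum]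
    rw [sum_matL_mul_cartan_mul_matL hN]
    by_cases hdf : d = f
    · rw [if_pos hdf, if_pos ⟨hdf, hrs⟩, ← zpow_neg, neg_neg, ← zpow_natCast, ← zpow_natCast,
        ← zpow_mul, ← zpow_mul]
      congr 1
      ring
    · rw [if_neg hdf, if_neg fun h => hdf h.1, mul_zero, zero_smul]
  · rw [if_neg fun h => hrs h.2]
    simp [hrs]

theorem commute_bosonTilde (hN : 3 ≤ N) (τ : ℂ) {d f : ZMod N} (hdf : d ≠ f) (r s : ℤ) :
    Commute (bosonTilde N τ d r) (bosonTilde N τ f s) := by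
  have h := bosonTilde_commutator hN τ d f r s
  rw [if_neg fun h => hdf h.1] at h
  exact sub_eq_zero.1 h

theorem bosonTilde_zero (τ : ℂ) (d : ZMod N) : bosonTilde N τ d 0 = 0 := by
  simp [bosonTilde, boson_zero]

theorem exp_zpow_ne_one {τ : ℂ} (hgen : ∀ r : ℕ, 0 < r → exp τ ^ r ≠ 1) {m : ℤ}
    (hm : m ≠ 0) : exp τ ^ m ≠ 1 := by
  intro h
  rcases lt_or_gt_of_ne hm with h0 | h0
  · refine hgen (-m).toNat (by omega) ?_
    rw [← zpow_natCast, Int.toNat_of_nonneg (by omega), zpow_neg, h, inv_one]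
  · refine hgen m.toNat (by omega) ?_
    rw [← zpow_natCast, Int.toNat_of_nonneg (by omega), h]

/-- The inverse of the deformed Cartan matrix is `L(x⁻¹) L(x)ᵀ`, up to a scalar. -/
theorem deformedCartan_inv (hN : 3 ≤ N) {τ : ℂ} {m : ℤ} (hm : m ≠ 0)
    (hX : (exp τ ^ (-m)) ^ N ≠ 1) (c : ZMod N) :
    (deformedCartan N 0 τ m)⁻¹ 0 c =
      (((exp τ ^ (-m)) ^ N - 1) * (((exp τ ^ (-m))⁻¹) ^ N - 1))⁻¹ *
        ∑ d : ZMod N, ((exp τ ^ (-m))⁻¹) ^ d.val * (exp τ ^ (-m)) ^ (d - c).val := by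
  set x := exp τ ^ (-m) with hxdef
  set k := (x ^ N - 1) * ((x⁻¹) ^ N - 1) with hk
  have hk0 : k ≠ 0 := by
    refine mul_ne_zero (sub_ne_zero.2 hX) (sub_ne_zero.2 fun h => hX ?_)
    rw [inv_pow] at h
    exact inv_eq_one.1 h
  set A : Matrix (ZMod N) (ZMod N) ℂ := Matrix.of fun c d => x ^ (d - c).val with hA
  set B : Matrix (ZMod N) (ZMod N) ℂ := Matrix.of fun c d => (x⁻¹) ^ (d - c).val with hB
  have h1 : (k⁻¹ • A.transpose) * (deformedCartan N 0 τ m * B) = 1 := by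
    rw [Matrix.smul_mul]
    ext d f
    rw [Matrix.smul_apply, Matrix.mul_apply]
    have h2 := sum_matL_mul_cartan_mul_matL hN τ m d f
    rw [← hxdef, ← hk] at h2
    have h3 : ∑ c, A.transpose d c * (deformedCartan N 0 τ m * B) c f =
        if d = f then k else 0 := by
      rw [← h2]
      refine Finset.sum_congr rfl fun c _ => ?_
      rw [Matrix.mul_apply, Finset.mul_sum]
      refine Finset.sum_congr rfl fun e _ => ?_
      rw [Matrix.transpose_apply, hA, hB, Matrix.of_apply, Matrix.of_apply,
        deformedCartan_zero τ c e hm]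
      ring
    rw [h3, Matrix.one_apply]
    split_ifs
    · exact inv_mul_cancel₀ hk0
    · exact smul_zero _
  have h4 : deformedCartan N 0 τ m * (B * (k⁻¹ • A.transpose)) = 1 := by
    rw [← Matrix.mul_assoc]
    exact mul_eq_one_comm.1 h1
  rw [Matrix.inv_eq_right_inv h4, Matrix.mul_smul, Matrix.smul_apply, Matrix.mul_apply, smul_eq_mul]
  congr 1
  refine Finset.sum_congr rfl fun d _ => ?_
  rw [Matrix.transpose_apply, hA, hB, Matrix.of_apply, Matrix.of_apply, sub_zero]

/-! ### The exponents of the vertex operators -/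

/-- The generating function of the boxes of colour `c` in terms of the characters of the quotients.
Both sides satisfy the same first-order recursion in `c`, which has only one solution on `ℤ / N`, as
`x^N ≠ 1`. -/
theorem sum_boxes_eq_sum_quotients {lam : YoungDiagram} {μ : ZMod N → YoungDiagram}
    (hμ : ∀ d, IsQuotient N lam d (μ d)) {x : ℂ} (hx : x ≠ 0) (hX : x ^ N ≠ 1) (c : ZMod N) :
    ∑ b ∈ lam.cells, (if color N b = c then x ^ (-content b) else 0) =
      ∑ d : ZMod N, ((character (μ d) (x ^ N) - ((x ^ N - 1) * ((x⁻¹) ^ N - 1))⁻¹) *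
          x ^ ((N : ℤ) * shift N lam d - (d.val : ℤ)) +
        ((x ^ N - 1) * ((x⁻¹) ^ N - 1))⁻¹ * (x⁻¹) ^ d.val) * x ^ (d - c).val := by
  set X := x ^ N with hXdef
  have hX0 : X ≠ 0 := pow_ne_zero _ hx
  have hX1 : X - 1 ≠ 0 := sub_ne_zero.2 hX
  have hX2 : X⁻¹ - 1 ≠ 0 := sub_ne_zero.2 fun h => hX (inv_eq_one.1 h)
  rw [inv_pow, ← hXdef]
  set E : ZMod N → ℂ := fun d => (character (μ d) X - ((X - 1) * (X⁻¹ - 1))⁻¹) *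
          x ^ ((N : ℤ) * shift N lam d - (d.val : ℤ)) +
        ((X - 1) * (X⁻¹ - 1))⁻¹ * (x⁻¹) ^ d.val with hE
  set A : ZMod N → ℂ := fun c => ∑ b ∈ lam.cells, (if color N b = c then x ^ (-content b) else 0)
    with hA
  set R : ZMod N → ℂ := fun c => ∑ d : ZMod N, E d * x ^ (d - c).val with hR
  have hRrec : ∀ d, R d - x * R (d + 1) = -(E d * (X - 1)) := by
    intro d
    have h1 : ∀ f : ZMod N, E f * x ^ (f - d).val - x * (E f * x ^ (f - (d + 1)).val) =
        if f = d then -(E d * (X - 1)) else 0 := by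
      intro f
      have h2 := pow_val_sub hx (f - (d + 1))
      rw [show f - (d + 1) + 1 = f - d by ring, if_congr sub_eq_zero rfl rfl, ← hXdef] at h2
      have h5 : x * x⁻¹ = 1 := mul_inv_cancel₀ hx
      split_ifs at h2 ⊢ with hfd
      · subst hfd
        linear_combination (-E f * x) * h2 + (-E f * x ^ (f - f).val - E f * (X - 1)) * h5
      · linear_combination (-E f * x) * h2 - E f * x ^ (f - d).val * h5
    rw [hR]
    simp only
    rw [Finset.mul_sum, ← Finset.sum_sub_distrib, Finset.sum_congr rfl fun f _ => h1 f,
      Finset.sum_ite_eq' Finset.univ d, if_pos (Finset.mem_univ d)]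
  have hArec : ∀ d, A d - x * A (d + 1) = -(E d * (X - 1)) := by
    intro d
    have h1 := sum_cells_quotient (hμ d) (fun n => x ^ (-n))
    set p := shift N lam d with hp
    have hφ : ∀ m : ℤ, x ^ (-((N : ℤ) * (m - p) + (d.val : ℤ))) =
        x ^ ((N : ℤ) * p - (d.val : ℤ)) * X ^ (-m) := by
      intro m
      rw [hXdef, ← zpow_natCast, ← zpow_mul, ← zpow_add₀ hx]
      congr 1
      ring
    have h2 : ∑ b ∈ lam.cells, ((if color N b = d then x ^ (-content b) else 0) -
        (if color N b = d + 1 then x ^ (-(content b - 1)) else 0)) = A d - x * A (d + 1) := by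
      rw [hA, Finset.sum_sub_distrib]
      simp only
      rw [Finset.mul_sum]
      congr 1
      refine Finset.sum_congr rfl fun b _ => ?_
      rw [neg_sub, sub_eq_add_neg, zpow_one_add₀ hx, mul_ite, mul_zero]
    have h3 : ∑ b ∈ (μ d).cells, (x ^ (-((N : ℤ) * (content b - p) + (d.val : ℤ))) -
        x ^ (-((N : ℤ) * (content b - 1 - p) + (d.val : ℤ)))) =
        x ^ ((N : ℤ) * p - (d.val : ℤ)) * (1 - X) * character (μ d) X := by
      rw [character, Finset.mul_sum]
      refine Finset.sum_congr rfl fun b _ => ?_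
      have h4 : X ^ (-(content b - 1)) = X * X ^ (-content b) := by
        rw [neg_sub, sub_eq_add_neg, zpow_one_add₀ hX0]
      rw [hφ, hφ, h4, ← neg_sub (b.1 : ℤ), ← content]
      ring
    have h4 : Finsupp.linearCombination ℤ
        (fun m : ℤ => x ^ (-((N : ℤ) * (m - p) + (d.val : ℤ)))) (stepProfile p) =
        x ^ ((N : ℤ) * p - (d.val : ℤ)) * (X ^ (-p) - 1) * (X⁻¹ - 1)⁻¹ := by
      have h5 := linearCombination_stepProfile (fun m : ℤ =>
        x ^ ((N : ℤ) * p - (d.val : ℤ)) * X ^ (-m) * (X⁻¹ - 1)⁻¹) p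
      rw [neg_zero, zpow_zero] at h5
      have h6 : (fun m : ℤ => x ^ (-((N : ℤ) * (m - p) + (d.val : ℤ)))) = fun m : ℤ =>
          x ^ ((N : ℤ) * p - (d.val : ℤ)) * X ^ (-(m + 1)) * (X⁻¹ - 1)⁻¹ -
            x ^ ((N : ℤ) * p - (d.val : ℤ)) * X ^ (-m) * (X⁻¹ - 1)⁻¹ := by
        funext m
        rw [hφ, neg_add, zpow_add₀ hX0, zpow_neg_one]
        field_simp
      rw [h6, h5]
      ring
    have h7 : x ^ ((N : ℤ) * p - (d.val : ℤ)) * X ^ (-p) = (x⁻¹) ^ d.val := by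
      rw [hXdef, ← zpow_natCast, ← zpow_natCast, ← zpow_mul, ← zpow_add₀ hx, inv_zpow, ← zpow_neg]
      congr 1
      ring
    rw [h2, h3, h4] at h1
    rw [h1, hE]
    simp only
    rw [mul_sub _ _ (1 : ℂ), h7, ← hp, mul_inv]
    have h8 : (X - 1) * (X - 1)⁻¹ = 1 := mul_inv_cancel₀ hX1
    linear_combination (x⁻¹ ^ d.val - x ^ ((N : ℤ) * p - (d.val : ℤ))) * (X⁻¹ - 1)⁻¹ * h8
  -- the difference of the two sides is multiplied by `x^N` on going once around `ℤ / N`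
  have hU : ∀ (n : ℕ) (d : ZMod N), A d - R d = x ^ n * (A (d + n) - R (d + n)) := by
    intro n
    induction n with
    | zero => intro d; simp
    | succ n ih =>
      intro d
      rw [ih d, pow_succ]
      have h1 := hArec (d + n)
      have h2 := hRrec (d + n)
      rw [add_assoc] at h1 h2
      push_cast
      linear_combination x ^ n * (h1 - h2)
  have h1 := hU N c
  rw [ZMod.natCast_self, add_zero, ← hXdef] at h1
  have h2 : (X - 1) * (A c - R c) = 0 := by linear_combination -h1
  exact sub_eq_zero.1 ((mul_eq_zero.1 h2).resolve_left hX1)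

theorem phiExponent_eq_bosons (τ ℓ : ℂ) (lam : YoungDiagram) (m : ℤ) :
    phiExponent N 0 τ ℓ lam m = ∑ c : ZMod N,
      (-(m : ℂ)⁻¹ * exp (-(m : ℂ) * ℓ) *
        ((∑ b ∈ lam.cells, if color N b = c then (exp τ ^ (-m)) ^ (-content b) else 0) -
          (deformedCartan N 0 τ m)⁻¹ 0 c)) • boson N 0 τ c m := by
  have hexp : ∀ b : ℕ × ℕ, exp (-(m : ℂ) * boxLog 0 τ ℓ b) =
      exp (-(m : ℂ) * ℓ) * (exp τ ^ (-m)) ^ (-content b) := by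
    intro b
    rw [← zpow_mul, ← exp_int_mul, ← exp_add, boxLog, content]
    congr 1
    push_cast
    ring
  have h1 : ∑ b ∈ lam.cells, etaExponent N 0 τ (color N b) (boxLog 0 τ ℓ b) m =
      ∑ c : ZMod N, (-(m : ℂ)⁻¹ * exp (-(m : ℂ) * ℓ) *
        ∑ b ∈ lam.cells, if color N b = c then (exp τ ^ (-m)) ^ (-content b) else 0) •
          boson N 0 τ c m := by
    simp only [Finset.mul_sum, Finset.sum_smul]
    rw [Finset.sum_comm]
    refine Finset.sum_congr rfl fun b _ => ?_
    rw [Finset.sum_eq_single (color N b)]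
    · rw [if_pos rfl, etaExponent, qInt_zero, mul_assoc, ← hexp]
      simp
    · intro c _ hc
      rw [if_neg (Ne.symm hc), mul_zero, zero_smul]
    · simp
  rw [phiExponent, h1, vacuumExponent, dualBoson, Finset.smul_sum, ← Finset.sum_add_distrib]
  refine Finset.sum_congr rfl fun c _ => ?_
  rw [smul_smul, ← add_smul, qInt_zero]
  congr 1
  simp only [mul_zero, zero_div, ite_self, add_zero]
  ring

theorem abelianExponent_eq_smul (τ ℓ : ℂ) (lam : YoungDiagram) (d : ZMod N) (μ : YoungDiagram)
    (m : ℤ) : abelianExponent N τ ℓ lam d μ m =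
      (-(m : ℂ)⁻¹ * exp (-(m : ℂ) * ℓ) * ((character μ ((exp τ ^ (-m)) ^ N) -
        (((exp τ ^ (-m)) ^ N - 1) * (((exp τ ^ (-m))⁻¹) ^ N - 1))⁻¹) *
          (exp τ ^ (-m)) ^ ((N : ℤ) * shift N lam d - (d.val : ℤ)))) • bosonTilde N τ d m := by
  rw [abelianExponent, psiExponent]
  congr 1
  have h1 : (exp τ ^ N) ^ (-m) = (exp τ ^ (-m)) ^ N := by
    rw [← zpow_natCast, ← zpow_natCast, zpow_comm]
  have h2 : (exp τ ^ N) ^ m = ((exp τ ^ (-m))⁻¹) ^ N := by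
    rw [← zpow_neg, neg_neg, ← zpow_natCast, ← zpow_natCast, zpow_comm]
  have h3 : exp ℓ ^ (-m) = exp (-(m : ℂ) * ℓ) := by
    rw [← exp_int_mul]
    push_cast
    rfl
  rw [h1, h2, mul_zpow, h3, zpow_comm, one_div, Int.cast_neg, inv_neg]
  ring

/-- The exponent of the toroidal intertwiner is the sum of those of the Abelian ones. -/
theorem phiExponent_eq_sum (hN : 3 ≤ N) {τ : ℂ} (hgen : ∀ r : ℕ, 0 < r → exp τ ^ r ≠ 1) (ℓ : ℂ)
    {lam : YoungDiagram} {μ : ZMod N → YoungDiagram} (hμ : ∀ d, IsQuotient N lam d (μ d)) :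
    phiExponent N 0 τ ℓ lam = ∑ d, abelianExponent N τ ℓ lam d (μ d) := by
  funext m
  rw [Finset.sum_apply]
  by_cases hm : m = 0
  · subst hm
    rw [phiExponent_eq_bosons]
    simp [boson_zero, abelianExponent_eq_smul, bosonTilde_zero]
  · have hX : (exp τ ^ (-m)) ^ N ≠ 1 := by
      rw [← zpow_natCast, ← zpow_mul]
      exact exp_zpow_ne_one hgen (mul_ne_zero (neg_ne_zero.2 hm)
        (Nat.cast_ne_zero.2 (NeZero.ne N)))
    have hx : exp τ ^ (-m) ≠ 0 := zpow_ne_zero _ (exp_ne_zero τ)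
    rw [phiExponent_eq_bosons]
    simp only [abelianExponent_eq_smul, bosonTilde_eq, Finset.smul_sum]
    rw [Finset.sum_comm]
    refine Finset.sum_congr rfl fun c _ => ?_
    rw [sum_boxes_eq_sum_quotients hμ hx hX, deformedCartan_inv hN hm hX, Finset.mul_sum,
      ← Finset.sum_sub_distrib, Finset.mul_sum, Finset.sum_smul]
    refine Finset.sum_congr rfl fun d _ => ?_
    rw [smul_smul]
    congr 1
    ring

theorem normalOrderable_abelianExponent (τ ℓ : ℂ) (lam : YoungDiagram) (d : ZMod N)
    (μ : YoungDiagram) : NormalOrderable (abelianExponent N τ ℓ lam d μ) := by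
  refine normalOrderable_of_bosons τ (a := fun c m => -(m : ℂ)⁻¹ * exp (-(m : ℂ) * ℓ) *
    ((character μ ((exp τ ^ (-m)) ^ N) -
      (((exp τ ^ (-m)) ^ N - 1) * (((exp τ ^ (-m))⁻¹) ^ N - 1))⁻¹) *
        (exp τ ^ (-m)) ^ ((N : ℤ) * shift N lam d - (d.val : ℤ))) *
      (exp τ ^ (-m)) ^ (d - c).val) fun m => ?_
  rw [abelianExponent_eq_smul, bosonTilde_eq, Finset.smul_sum]
  exact Finset.sum_congr rfl fun c _ => smul_smul _ _ _

theorem normalOrderable_phiExponent (τ ℓ : ℂ) (lam : YoungDiagram) :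
    NormalOrderable (phiExponent N 0 τ ℓ lam) :=
  normalOrderable_of_bosons τ (phiExponent_eq_bosons τ ℓ lam)

theorem commute_abelianExponent (hN : 3 ≤ N) (τ ℓ : ℂ) (lam : YoungDiagram)
    {d f : ZMod N} (hdf : d ≠ f) (μ ν : YoungDiagram) (m n : ℤ) :
    Commute (abelianExponent N τ ℓ lam d μ m) (abelianExponent N τ ℓ lam f ν n) := by
  rw [abelianExponent_eq_smul, abelianExponent_eq_smul]
  exact ((commute_bosonTilde hN τ hdf m n).smul_left _).smul_right _

end

/-! ### Zero modes -/

section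

variable {N : ℕ} [NeZero N]

theorem sum_range_cast {A : Type*} [AddCommMonoid A] (F : ZMod N → A) :
    ((List.range N).map fun d : ℕ => F (d : ZMod N)).sum = ∑ d, F d := by
  have h : ((List.range N).map fun d : ℕ => F (d : ZMod N)).sum =
      ∑ d ∈ Finset.range N, F (d : ZMod N) := rfl
  rw [h]
  refine Finset.sum_nbij' (fun d => (d : ZMod N)) ZMod.val ?_ ?_ ?_ ?_ ?_
  · intro d _
    exact Finset.mem_univ _
  · intro d _
    exact Finset.mem_range.2 (ZMod.val_lt d)
  · intro d hd
    exact ZMod.val_natCast_of_lt (Finset.mem_range.1 hd)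
  · intro d _
    exact ZMod.natCast_zmod_val d
  · intro d _
    rfl

theorem sum_weightLattice (x : weightLattice N) : ∑ d, x.1 d = 0 := by
  obtain ⟨x, hx⟩ := x
  refine AddSubgroup.closure_induction (p := fun x _ => ∑ d, x d = 0) ?_ ?_ ?_ ?_ hx
  · rintro _ ⟨d, rfl⟩
    have h : (N : ℚ) ≠ 0 := Nat.cast_ne_zero.2 (NeZero.ne N)
    simp only [tildeAlphaVec, Finset.sum_sub_distrib, Finset.sum_ite_eq', Finset.mem_univ, if_true,
      Finset.sum_const, Finset.card_univ, ZMod.card, nsmul_eq_mul]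
    field_simp
    ring
  · simp
  · intro x y _ _ hx hy
    simp [Finset.sum_add_distrib, hx, hy]
  · intro x _ hx
    simp [hx]

theorem diagOp_single {N : ℕ} (φ : weightLattice N → ℂ) (x : weightLattice N) (p : Osc N) :
    diagOp φ (Finsupp.single x p) = φ x • Finsupp.single x p := by
  simp [diagOp]

theorem expOp_single (β x : weightLattice N) (p : Osc N) :
    expOp β (Finsupp.single x p) = cocycle β x • Finsupp.single (x + β) p := by
  simp [expOp]

theorem diagOp_mul {N : ℕ} (φ ψ : weightLattice N → ℂ) :
    diagOp φ * diagOp ψ = diagOp fun x => φ x * ψ x := by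
  refine Finsupp.lhom_ext fun x p => ?_
  rw [Module.End.mul_apply, diagOp_single, map_smul, diagOp_single, diagOp_single, smul_smul,
    mul_comm]

theorem diagOp_one {N : ℕ} : diagOp (fun _ : weightLattice N => 1) = 1 := by
  refine Finsupp.lhom_ext fun x p => ?_
  rw [diagOp_single, one_smul, Module.End.one_apply]

theorem prod_diagOp_exp {N : ℕ} {ι : Type*} (l : List ι) (g : ι → weightLattice N → ℂ) :
    (l.map fun d => diagOp fun x => exp (g d x)).prod =
      diagOp fun x => exp ((l.map fun d => g d x).sum) := by
  induction l with
  | nil => simp [diagOp_one]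
  | cons d l ih =>
    rw [List.map_cons, List.prod_cons, ih, diagOp_mul]
    simp only [List.map_cons, List.sum_cons, exp_add]

/-- The relation between consecutive shifts also holds across `N - 1 → 0`, because the coordinates of
a weight sum to zero. -/
theorem tildeShift_add_one (d : ZMod N) (x : weightLattice N) :
    tildeShift (d + 1) x = tildeShift d x - (x.1 (d + 1) + x.1 d) / 2 := by
  have hlt := ZMod.val_lt d
  have hval : ((d + 1).val : ℤ) = ((d.val : ℤ) + 1) % N := by
    rw [← ZMod.val_intCast]
    simp
  have hsum : ∑ f : ZMod N, (if f.val < d.val + 1 then x.1 f else 0) =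
      (∑ f : ZMod N, if f.val < d.val then x.1 f else 0) + x.1 d := by
    have h1 : x.1 d = ∑ f : ZMod N, if f = d then x.1 f else 0 := by simp
    rw [h1, ← Finset.sum_add_distrib]
    refine Finset.sum_congr rfl fun f _ => ?_
    by_cases hf : f = d
    · subst hf
      simp
    · have : f.val ≠ d.val := fun h => hf (ZMod.val_injective N h)
      rw [if_neg hf, add_zero]
      exact if_congr (by omega) rfl rfl
  have hnext : ∑ f : ZMod N, (if f.val < (d + 1).val then x.1 f else 0) =
      (∑ f : ZMod N, if f.val < d.val then x.1 f else 0) + x.1 d := by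
    rw [← hsum]
    by_cases h : d.val + 1 = N
    · have h0 : (d + 1).val = 0 := by
        have h2 : ((d.val : ℤ) + 1) % N = 0 := by
          rw [show (d.val : ℤ) + 1 = N by exact_mod_cast h, Int.emod_self]
        omega
      rw [h0, h]
      simp only [ZMod.val_lt, if_true, not_lt_zero, if_false, Finset.sum_const_zero]
      exact (sum_weightLattice x).symm
    · rw [Int.emod_eq_of_lt (by omega) (by omega)] at hval
      rw [show (d + 1).val = d.val + 1 by omega]
  rw [tildeShift, tildeShift, hnext]
  ring

theorem sum_tildeShift (x : weightLattice N) : ∑ d, tildeShift d x = 0 := by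
  have hcount : ∀ f : ZMod N, ∑ d : ZMod N, (if f.val < d.val then x.1 f else 0) =
      ((N : ℚ) - 1 - f.val) * x.1 f := by
    intro f
    have hlt := ZMod.val_lt f
    rw [← sum_range_cast fun d => if f.val < d.val then x.1 f else 0]
    have h1 : ((List.range N).map fun d : ℕ => if f.val < (d : ZMod N).val then x.1 f else 0).sum =
      ∑ d ∈ Finset.range N, if f.val < (d : ZMod N).val then x.1 f else 0 := rfl
    have h2 : ∑ d ∈ Finset.range N, (if f.val < (d : ZMod N).val then x.1 f else 0) =
        ∑ d ∈ Finset.range (f.val + 1 + (N - f.val - 1)), if f.val < d then x.1 f else 0 := by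
      rw [show f.val + 1 + (N - f.val - 1) = N by omega]
      refine Finset.sum_congr rfl fun d hd => ?_
      rw [ZMod.val_natCast_of_lt (Finset.mem_range.1 hd)]
    rw [h1, h2, Finset.sum_range_add, Finset.sum_eq_zero, zero_add,
      Finset.sum_congr rfl (g := fun _ => x.1 f)]
    · rw [Finset.sum_const, Finset.card_range, nsmul_eq_mul, Nat.cast_sub (by omega),
        Nat.cast_sub (by omega)]
      push_cast
      ring
    · intro d _
      rw [if_pos (by omega)]
    · intro d hd
      rw [Finset.mem_range] at hd
      rw [if_neg (by omega)]
  have hN : (N : ℚ) ≠ 0 := Nat.cast_ne_zero.2 (NeZero.ne N)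
  simp only [tildeShift, Finset.sum_sub_distrib]
  rw [Finset.sum_comm (f := fun d f : ZMod N => if f.val < d.val then x.1 f else 0),
    Finset.sum_congr rfl fun f _ => hcount f]
  simp only [sub_mul, Finset.sum_sub_distrib, one_mul, Finset.sum_const, Finset.card_univ,
    ZMod.card, nsmul_eq_mul, ← Finset.mul_sum, ← Finset.sum_div, Finset.sum_neg_distrib, sum_weightLattice]
  field_simp
  ring

theorem powH_mul_powHTilde (τ : ℂ) (c : ZMod N) (y : ℂ) :
    powH τ c y * powHTilde τ (c - 1) y 1 = powHTilde τ c y 1 := by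
  rw [powH, powHTilde, powHTilde, diagOp_mul]
  congr 1
  funext x
  have h := tildeShift_add_one (c - 1) x
  rw [sub_add_cancel] at h
  rw [← exp_add, h]
  congr 1
  push_cast
  ring

theorem prod_powHTilde (τ y : ℂ) :
    ((List.range N).map fun d : ℕ => powHTilde τ (d : ZMod N) y 1).prod = 1 := by
  simp only [powHTilde]
  rw [prod_diagOp_exp, ← diagOp_one]
  congr 1
  funext x
  rw [sum_range_cast fun d : ZMod N => y * ((x.1 d : ℚ) : ℂ) +
    ((1 : ℤ) : ℂ) * τ * ((tildeShift d x : ℚ) : ℂ), Finset.sum_add_distrib, ← Finset.mul_sum,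
    ← Finset.mul_sum, ← Rat.cast_sum, ← Rat.cast_sum, sum_weightLattice, sum_tildeShift]
  simp

/-- The coordinate `x ↦ x_d` on the weight lattice. -/
noncomputable def coord (d : ZMod N) : weightLattice N →+ ℂ :=
  AddMonoidHom.mk' (fun x => ((x.1 d : ℚ) : ℂ)) fun x y => by
    rw [AddSubgroup.coe_add, Pi.add_apply, Rat.cast_add]

theorem coord_apply {N : ℕ} (d : ZMod N) (x : weightLattice N) :
    coord d x = ((x.1 d : ℚ) : ℂ) := rfl

/-- The map `tildeShift` as a homomorphism. -/
noncomputable def tildeShiftHom (d : ZMod N) : weightLattice N →+ ℂ :=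
  -((1 / 2 : ℂ) • coord d) - (∑ f : ZMod N, if f.val < d.val then coord f else 0)
    - (1 / (N : ℂ)) • ∑ f : ZMod N, (f.val : ℂ) • coord f

theorem tildeShiftHom_apply (d : ZMod N) (x : weightLattice N) :
    tildeShiftHom d x = ((tildeShift d x : ℚ) : ℂ) := by
  have h : ∀ f : ZMod N, (if f.val < d.val then coord f else 0) x =
      if f.val < d.val then ((x.1 f : ℚ) : ℂ) else 0 := by
    intro f
    split_ifs <;> simp [coord_apply]
  simp only [tildeShiftHom, tildeShift, AddMonoidHom.sub_apply, AddMonoidHom.neg_apply,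
    AddMonoidHom.smul_apply, AddMonoidHom.finsetSum_apply, coord_apply, smul_eq_mul, h]
  push_cast
  congr 2
  · ring
  · exact Finset.sum_congr rfl fun f _ => by split_ifs <;> simp

/-- The bilinear form whose exponential is the cocycle. -/
noncomputable def cocycleForm : weightLattice N →+ weightLattice N →+ ℂ :=
  AddMonoidHom.mk' (fun β => ∑ f : ZMod N, ∑ g : ZMod N,
      if g.val < f.val then (Real.pi * I * coord f β) • coord g else 0) fun β γ => by
    simp only [← Finset.sum_add_distrib]
    refine Finset.sum_congr rfl fun f _ => Finset.sum_congr rfl fun g _ => ?_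
    split_ifs
    · rw [map_add, mul_add, add_smul]
    · rw [add_zero]

theorem cocycle_eq_exp (β x : weightLattice N) : cocycle β x = exp (cocycleForm β x) := by
  rw [cocycle, cocycleForm, AddMonoidHom.mk'_apply]
  simp only [AddMonoidHom.finsetSum_apply]
  push_cast
  rw [Finset.mul_sum]
  congr 1
  refine Finset.sum_congr rfl fun f _ => ?_
  rw [Finset.mul_sum]
  refine Finset.sum_congr rfl fun g _ => ?_
  split_ifs
  · rw [AddMonoidHom.smul_apply, coord_apply, coord_apply, smul_eq_mul]
    push_cast
    ring
  · simp

/-- The operator `O` shifts the momentum by `β` and multiplies by `s exp (χ x)` on momentum `x`, for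
some nonzero constant `s`.  Such operators are determined by `β` and `χ` up to a nonzero scalar. -/
def IsWeyl (β : weightLattice N) (χ : weightLattice N →+ ℂ) (O : Module.End ℂ (Fock N)) : Prop :=
  ∃ s : ℂ, s ≠ 0 ∧ ∀ (x : weightLattice N) (p : Osc N),
    O (Finsupp.single x p) = (s * exp (χ x)) • Finsupp.single (x + β) p

theorem IsWeyl.mul {N : ℕ} {β β' : weightLattice N} {χ χ' : weightLattice N →+ ℂ}
    {O O' : Module.End ℂ (Fock N)} (h : IsWeyl β χ O) (h' : IsWeyl β' χ' O') :
    IsWeyl (β + β') (χ + χ') (O * O') := by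
  obtain ⟨s, hs, h⟩ := h
  obtain ⟨s', hs', h'⟩ := h'
  refine ⟨s * s' * exp (χ β'), mul_ne_zero (mul_ne_zero hs hs') (exp_ne_zero _), fun x p => ?_⟩
  rw [Module.End.mul_apply, h', map_smul, h, smul_smul, AddMonoidHom.add_apply, map_add, exp_add,
    exp_add, add_assoc, add_comm β' β]
  congr 1
  ring

theorem isWeyl_one {N : ℕ} : IsWeyl (0 : weightLattice N) 0 1 :=
  ⟨1, one_ne_zero, fun x p => by simp⟩

theorem isWeyl_list_prod {N : ℕ} {ι : Type*} {β : ι → weightLattice N}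
    {χ : ι → weightLattice N →+ ℂ}
    {O : ι → Module.End ℂ (Fock N)} (h : ∀ i, IsWeyl (β i) (χ i) (O i)) (l : List ι) :
    IsWeyl (l.map β).sum (l.map χ).sum (l.map O).prod := by
  induction l with
  | nil => exact isWeyl_one
  | cons i l ih => exact (h i).mul ih

theorem IsWeyl.exists_eq_smul {N : ℕ} {β : weightLattice N} {χ : weightLattice N →+ ℂ}
    {O O' : Module.End ℂ (Fock N)} (h : IsWeyl β χ O) (h' : IsWeyl β χ O') :
    ∃ s : ℂ, s ≠ 0 ∧ O = s • O' := by
  obtain ⟨s, hs, h⟩ := h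
  obtain ⟨s', hs', h'⟩ := h'
  refine ⟨s / s', div_ne_zero hs hs', Finsupp.lhom_ext fun x p => ?_⟩
  rw [LinearMap.smul_apply, h, h', smul_smul]
  congr 1
  field_simp

theorem IsWeyl.commute_boson {β : weightLattice N} {χ : weightLattice N →+ ℂ}
    {O : Module.End ℂ (Fock N)} (h : IsWeyl β χ O) (ε τ : ℂ) (c : ZMod N) (m : ℤ) :
    Commute O (boson N ε τ c m) := by
  obtain ⟨s, _, h⟩ := h
  refine Finsupp.lhom_ext fun x p => ?_
  rw [Module.End.mul_apply, Module.End.mul_apply, h, map_smul, boson,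
    Finsupp.mapRange.linearMap_apply, Finsupp.mapRange.linearMap_apply, Finsupp.mapRange_single,
    Finsupp.mapRange_single, h]

theorem isWeyl_expOp (β : weightLattice N) : IsWeyl β (cocycleForm β) (expOp β) :=
  ⟨1, one_ne_zero, fun x p => by rw [expOp_single, one_mul, cocycle_eq_exp]⟩

theorem isWeyl_diagOp {N : ℕ} {φ : weightLattice N → ℂ} {χ : weightLattice N →+ ℂ}
    (h : ∀ x, φ x = exp (χ x)) : IsWeyl 0 χ (diagOp φ) :=
  ⟨1, one_ne_zero, fun x p => by rw [diagOp_single, one_mul, h, add_zero]⟩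

theorem isWeyl_zeroModeBox (τ ℓ : ℂ) (b : ℕ × ℕ) :
    IsWeyl (simpleRoot N (color N b)) (cocycleForm (simpleRoot N (color N b)) +
      ((ℓ + τ * (-(content b : ℂ) - 1 / 2)) • coord (color N b) -
        (ℓ + τ * (-((content b - 1 : ℤ) : ℂ) - 1 / 2)) • coord (color N b - 1)))
      (zeroModeBox N 0 τ ℓ b) := by
  have h : IsWeyl 0 ((ℓ + τ * (-(content b : ℂ) - 1 / 2)) • coord (color N b) -
      (ℓ + τ * (-((content b - 1 : ℤ) : ℂ) - 1 / 2)) • coord (color N b - 1))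
      (powH τ (color N b) (boxLog 0 τ ℓ b)) := by
    refine isWeyl_diagOp fun x => ?_
    rw [AddMonoidHom.sub_apply, AddMonoidHom.smul_apply, AddMonoidHom.smul_apply, coord_apply,
      coord_apply, smul_eq_mul, smul_eq_mul, boxLog, content]
    congr 1
    push_cast
    ring
  have h1 := (isWeyl_expOp (simpleRoot N (color N b))).mul h
  rw [add_zero] at h1
  obtain ⟨s, hs, h2⟩ := h1
  refine ⟨exp (boxLog 0 τ ℓ b) * s, mul_ne_zero (exp_ne_zero _) hs, fun x p => ?_⟩
  rw [zeroModeBox, LinearMap.smul_apply, h2, smul_smul, mul_assoc]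

theorem isWeyl_zeroFactor (τ ℓ : ℂ) (lam : YoungDiagram) (d : ZMod N) (μ : YoungDiagram) :
    IsWeyl (-(shift N lam d) • tildeAlpha N d) (cocycleForm (-(shift N lam d) • tildeAlpha N d) +
      (((zeroExponent N lam d μ : ℂ) * τ - (shift N lam d : ℂ) * ℓ) • coord d -
        ((shift N lam d : ℂ) * τ) • tildeShiftHom d)) (zeroFactor N τ ℓ lam d μ) := by
  have h : IsWeyl 0 (((zeroExponent N lam d μ : ℂ) * τ - (shift N lam d : ℂ) * ℓ) • coord d -
        ((shift N lam d : ℂ) * τ) • tildeShiftHom d) (powHTilde τ d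
      ((zeroExponent N lam d μ : ℂ) * τ - (shift N lam d : ℂ) * ℓ) (-(shift N lam d))) := by
    refine isWeyl_diagOp fun x => ?_
    rw [AddMonoidHom.sub_apply, AddMonoidHom.smul_apply, AddMonoidHom.smul_apply, coord_apply,
      tildeShiftHom_apply, smul_eq_mul, smul_eq_mul]
    congr 1
    push_cast
    ring
  have h1 := (isWeyl_expOp (-(shift N lam d) • tildeAlpha N d)).mul h
  rw [add_zero] at h1
  exact h1

theorem sum_boxList {A : Type*} [AddCommMonoid A] (lam : YoungDiagram) (F : ℕ × ℕ → A) :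
    ((boxList lam).reverse.map F).sum = ∑ b ∈ lam.cells, F b := by
  have hnodup : (boxList lam).Nodup := by
    rw [boxList, List.nodup_flatMap]
    refine ⟨fun i _ => List.nodup_range.map fun a b h => (Prod.mk.inj h).2, ?_⟩
    refine List.nodup_range.imp fun {a b} hab => ?_
    rw [Function.onFun, List.disjoint_left]
    intro c hc hc'
    obtain ⟨_, _, rfl⟩ := List.mem_map.1 hc
    obtain ⟨_, _, h⟩ := List.mem_map.1 hc'
    exact hab (Prod.mk.inj h).1.symm
  rw [← List.sum_toFinset F (List.nodup_reverse.2 hnodup), List.toFinset_reverse]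
  refine Finset.sum_congr ?_ fun _ _ => rfl
  ext ⟨i, j⟩
  rw [List.mem_toFinset, boxList, YoungDiagram.mem_cells]
  simp only [List.mem_flatMap, List.mem_range, List.mem_map, Prod.mk.injEq]
  constructor
  · rintro ⟨i', _, j', h, rfl, rfl⟩
    exact YoungDiagram.mem_iff_lt_rowLen.2 h
  · intro h
    exact ⟨i, YoungDiagram.mem_iff_lt_colLen.1 (lam.up_left_mem le_rfl (Nat.zero_le j) h), j,
      YoungDiagram.mem_iff_lt_rowLen.1 h, rfl, rfl⟩

/-- A sum of boundary terms over the boxes, collected by colour. -/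
theorem sum_cells_smul_colors {R A : Type*} [Ring R] [AddCommGroup A] [Module R A]
    (lam : YoungDiagram) (u w : ℕ × ℕ → R) (F : ZMod N → A) :
    ∑ b ∈ lam.cells, (u b • F (color N b) - w b • F (color N b - 1)) =
      ∑ d, (∑ b ∈ lam.cells, ((if color N b = d then u b else 0) -
        (if color N b = d + 1 then w b else 0))) • F d := by
  simp only [Finset.sum_smul]
  rw [Finset.sum_comm]
  refine Finset.sum_congr rfl fun b _ => ?_
  simp only [sub_smul, Finset.sum_sub_distrib, ite_smul, zero_smul, Finset.sum_ite_eq,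
    ← sub_eq_iff_eq_add, Finset.mem_univ, if_true]

/-- The total momentum shifts of the two sides agree. -/
theorem sum_simpleRoot {lam : YoungDiagram} {μ : ZMod N → YoungDiagram}
    (hμ : ∀ d, IsQuotient N lam d (μ d)) :
    ∑ b ∈ lam.cells, simpleRoot N (color N b) = ∑ d, -(shift N lam d) • tildeAlpha N d := by
  have h1 := sum_cells_smul_colors lam (fun _ => (1 : ℤ)) (fun _ => 1) (tildeAlpha N)
  simp only [one_smul] at h1
  simp only [simpleRoot]
  rw [h1]
  refine Finset.sum_congr rfl fun d _ => ?_
  congr 1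
  have h2 := sum_cells_quotient (hμ d) (fun _ => (1 : ℤ))
  have h3 := linearCombination_stepProfile (fun m : ℤ => m) (shift N lam d)
  simp only [add_sub_cancel_left, sub_zero] at h3
  rw [h2, h3]
  simp

/-- The floor is `-1` or `0`, so both sides are sums over pairs of distinct colours. -/
theorem sum_floor_mul (p : ZMod N → ℤ) (x : ZMod N → ℂ) :
    ∑ d, ((∑ f : ZMod N, ⌊((d.val : ℚ) - (f.val : ℚ)) / (N : ℚ)⌋ * p f : ℤ) : ℂ) * x d =
      -∑ d, (p d : ℂ) * ∑ f : ZMod N, if f.val < d.val then x f else 0 := by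
  have hfloor : ∀ d f : ZMod N, ⌊((d.val : ℚ) - (f.val : ℚ)) / (N : ℚ)⌋ =
      if d.val < f.val then -1 else 0 := by
    intro d f
    have h1 : (0 : ℚ) < N := Nat.cast_pos.2 (Nat.pos_of_ne_zero (NeZero.ne N))
    have h2 : (d.val : ℚ) < N := Nat.cast_lt.2 (ZMod.val_lt d)
    have h3 : (f.val : ℚ) < N := Nat.cast_lt.2 (ZMod.val_lt f)
    have h4 : (0 : ℚ) ≤ d.val := Nat.cast_nonneg _
    have h5 : (0 : ℚ) ≤ f.val := Nat.cast_nonneg _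
    rw [Int.floor_eq_iff, le_div_iff₀ h1, div_lt_iff₀ h1]
    split_ifs with h
    · have h6 : (d.val : ℚ) < f.val := Nat.cast_lt.2 h
      constructor <;> push_cast <;> linarith
    · have h6 : (f.val : ℚ) ≤ d.val := Nat.cast_le.2 (not_lt.1 h)
      constructor <;> push_cast <;> linarith
  simp only [hfloor, Int.cast_sum, Finset.sum_mul, Finset.mul_sum]
  rw [Finset.sum_comm, ← Finset.sum_neg_distrib]
  refine Finset.sum_congr rfl fun d _ => ?_
  rw [← Finset.sum_neg_distrib]
  refine Finset.sum_congr rfl fun f _ => ?_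
  split_ifs <;> push_cast <;> ring

/-- The momentum dependence of the two sides agrees. -/
theorem sum_zeroMode_characters (τ ℓ : ℂ) {lam : YoungDiagram} {μ : ZMod N → YoungDiagram}
    (hμ : ∀ d, IsQuotient N lam d (μ d)) :
    ∑ b ∈ lam.cells, ((ℓ + τ * (-(content b : ℂ) - 1 / 2)) • coord (color N b) -
        (ℓ + τ * (-((content b - 1 : ℤ) : ℂ) - 1 / 2)) • coord (color N b - 1)) =
      ∑ d, (((zeroExponent N lam d (μ d) : ℂ) * τ - (shift N lam d : ℂ) * ℓ) • coord d -
        ((shift N lam d : ℂ) * τ) • tildeShiftHom d) := by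
  -- this `G` makes the summand for a box of content `c` equal to
  -- `G c • coord d - G (c - 1) • coord (d - 1)`, where `d` is its colour
  set G : ℤ → ℂ := fun n => ℓ + τ * (-(n : ℂ) - 1 / 2) with hG
  have h1 := sum_cells_smul_colors lam (fun b => G (content b)) (fun b => G (content b - 1))
    (coord (N := N))
  refine h1.trans ?_
  have hcoeff : ∀ d : ZMod N, ∑ b ∈ lam.cells, ((if color N b = d then G (content b) else 0) -
        (if color N b = d + 1 then G (content b - 1) else 0)) =
      (zeroExponent N lam d (μ d) : ℂ) * τ - (shift N lam d : ℂ) * ℓ + τ * (shift N lam d / 2) -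
        τ * ((∑ f : ZMod N, ⌊((d.val : ℚ) - (f.val : ℚ)) / (N : ℚ)⌋ * shift N lam f : ℤ) : ℂ) := by
    intro d
    rw [sum_cells_quotient (hμ d) G, zeroExponent]
    set p := shift N lam d with hp
    have h2 := linearCombination_stepProfile (fun m : ℤ => (ℓ + τ * (N * p - d.val - 1 / 2)) * m -
      τ * N * (m * (m - 1) / 2)) p
    have h3 : (fun m : ℤ => G ((N : ℤ) * (m - p) + (d.val : ℤ))) = fun m : ℤ =>
        ((ℓ + τ * (N * p - d.val - 1 / 2)) * ((m + 1 : ℤ) : ℂ) -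
          τ * N * (((m + 1 : ℤ) : ℂ) * (((m + 1 : ℤ) : ℂ) - 1) / 2)) -
        ((ℓ + τ * (N * p - d.val - 1 / 2)) * m - τ * N * (m * (m - 1) / 2)) := by
      funext m
      rw [hG]
      push_cast
      ring
    have h4 : ∑ b ∈ (μ d).cells, (G ((N : ℤ) * (content b - p) + (d.val : ℤ)) -
        G ((N : ℤ) * (content b - 1 - p) + (d.val : ℤ))) = -((μ d).card : ℂ) * N * τ := by
      rw [Finset.sum_congr rfl (g := fun _ => -(N : ℂ) * τ), Finset.sum_const, nsmul_eq_mul]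
      · ring
      · intro b _
        rw [hG]
        push_cast
        ring
    have h5 : ((p * (p + 1) / 2 : ℤ) : ℂ) = (p : ℂ) * (p + 1) / 2 := by
      rw [Int.cast_div (Int.even_mul_succ_self p).two_dvd (by norm_num)]
      push_cast
      ring
    rw [h3, h2, h4]
    push_cast [h5]
    ring
  rw [Finset.sum_congr rfl fun d _ => by rw [hcoeff d]]
  refine AddMonoidHom.ext fun x => ?_
  simp only [AddMonoidHom.finsetSum_apply, AddMonoidHom.sub_apply, AddMonoidHom.smul_apply,
    smul_eq_mul]
  have h6 := sum_floor_mul (shift N lam) (fun d => coord d x)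
  have h7 : ∑ d : ZMod N, (shift N lam d : ℂ) = 0 := by
    rw [← Int.cast_sum, sum_shift, Int.cast_zero]
  -- the part of `tildeShift` that does not depend on `d` drops out, as the shifts sum to zero
  set W : ℂ := (1 / (N : ℂ)) * ∑ f : ZMod N, (f.val : ℂ) * coord f x with hW
  have h8 : ∀ d : ZMod N, tildeShiftHom d x = -(1 / 2 * coord d x) -
      (∑ f : ZMod N, if f.val < d.val then coord f x else 0) - W := by
    intro d
    rw [hW, tildeShiftHom]
    simp only [AddMonoidHom.sub_apply, AddMonoidHom.neg_apply, AddMonoidHom.smul_apply,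
      AddMonoidHom.finsetSum_apply, smul_eq_mul]
    congr 2
    refine Finset.sum_congr rfl fun f _ => ?_
    split_ifs <;> rfl
  simp only [h8]
  rw [← sub_eq_zero, ← Finset.sum_sub_distrib, Finset.sum_congr rfl (g := fun d : ZMod N =>
    -τ * (((∑ f : ZMod N, ⌊((d.val : ℚ) - (f.val : ℚ)) / (N : ℚ)⌋ * shift N lam f : ℤ) : ℂ) *
      coord d x) -
      τ * ((shift N lam d : ℂ) * ∑ f : ZMod N, if f.val < d.val then coord f x else 0) -
      τ * W * (shift N lam d : ℂ)) fun d _ => by ring, Finset.sum_sub_distrib,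
    Finset.sum_sub_distrib, ← Finset.mul_sum, ← Finset.mul_sum, ← Finset.mul_sum, h6, h7]
  ring

/-- The group algebra part of the toroidal intertwiner is proportional to the product of the zero
mode factors. -/
theorem exists_zLam_eq_smul (τ ℓ : ℂ) {lam : YoungDiagram} {μ : ZMod N → YoungDiagram}
    (hμ : ∀ d, IsQuotient N lam d (μ d)) : ∃ s : ℂ, s ≠ 0 ∧ zLam N 0 τ ℓ lam =
      s • ((List.range N).map fun d : ℕ => zeroFactor N τ ℓ lam (d : ZMod N) (μ d)).prod := by
  have h1 := isWeyl_list_prod (isWeyl_zeroModeBox (N := N) τ ℓ) (boxList lam).reverse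
  have h2 := isWeyl_list_prod
    (fun d : ℕ => isWeyl_zeroFactor (N := N) τ ℓ lam (d : ZMod N) (μ d)) (List.range N)
  rw [sum_boxList, sum_boxList, Finset.sum_add_distrib, ← map_sum, sum_simpleRoot hμ,
    sum_zeroMode_characters τ ℓ hμ] at h1
  rw [sum_range_cast fun d : ZMod N => -(shift N lam d) • tildeAlpha N d,
    sum_range_cast fun d : ZMod N => cocycleForm (-(shift N lam d) • tildeAlpha N d) +
      (((zeroExponent N lam d (μ d) : ℂ) * τ - (shift N lam d : ℂ) * ℓ) • coord d -
        ((shift N lam d : ℂ) * τ) • tildeShiftHom d), Finset.sum_add_distrib, ← map_sum] at h2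
  exact h1.exists_eq_smul h2

end

/-! ### The factorization -/

theorem normC_ne_zero {N : ℕ} {τ : ℂ} (hgen : ∀ r : ℕ, 0 < r → exp τ ^ r ≠ 1) (lam : YoungDiagram) :
    normC N 0 τ lam ≠ 0 := by
  refine Finset.prod_ne_zero_iff.2 fun b _ => ?_
  rw [sub_ne_zero]
  intro h
  refine hgen (arm lam b + leg lam b + 1) (Nat.succ_pos _) ?_
  rw [h, ← exp_nat_mul]
  congr 1
  push_cast
  ring

/-- The scalar prefactor of the intertwiner does not vanish. -/
theorem prefactor_ne_zero {N : ℕ} {τ : ℂ} (hgen : ∀ r : ℕ, 0 < r → exp τ ^ r ≠ 1) (ℓ : ℂ) {u : ℂ}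
    (hu : u ≠ 0) (M : ℤ) (lam : YoungDiagram) :
    normT N 0 τ lam / normC N 0 τ lam * u ^ countZero N lam *
      (-exp ℓ) ^ (-M * (countZero N lam : ℤ)) * framing N 0 τ lam ^ (-M - 1) ≠ 0 := by
  have hT : normT N 0 τ lam ≠ 0 :=
    mul_ne_zero (Finset.prod_ne_zero_iff.2 fun b _ => exp_ne_zero _)
      (Finset.prod_ne_zero_iff.2 fun b _ => neg_ne_zero.2 (exp_ne_zero _))
  have hf : framing N 0 τ lam ≠ 0 :=
    Finset.prod_ne_zero_iff.2 fun b _ => neg_ne_zero.2 (exp_ne_zero _)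
  exact mul_ne_zero (mul_ne_zero (mul_ne_zero (div_ne_zero hT (normC_ne_zero hgen lam))
    (pow_ne_zero _ hu)) (zpow_ne_zero _ (neg_ne_zero.2 (exp_ne_zero _)))) (zpow_ne_zero _ hf)

section

variable {N : ℕ} [NeZero N]

/-- The residues `0, …, N - 1` as colours. -/
def colorEquiv (N : ℕ) [NeZero N] : Fin N ≃ ZMod N where
  toFun i := (i.val : ZMod N)
  invFun d := ⟨d.val, ZMod.val_lt d⟩
  left_inv i := Fin.ext (ZMod.val_natCast_of_lt i.isLt)
  right_inv d := ZMod.natCast_zmod_val d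

theorem commute_zeroFactor_abelian (τ ℓ : ℂ) (lam : YoungDiagram) (d e : ZMod N)
    (μ ν : YoungDiagram) (k : ℤ) : Commute (zeroFactor N τ ℓ lam d μ)
      (normalExpLin _ (normalOrderable_abelianExponent τ ℓ lam e ν) k) := by
  refine commute_normalExpLin _ (fun m => ?_) k
  rw [abelianExponent_eq_smul, bosonTilde_eq]
  exact (Commute.sum_right _ _ _ fun c _ =>
    ((isWeyl_zeroFactor τ ℓ lam d μ).commute_boson 0 τ c m).smul_right _).smul_right _

theorem foldr_range_mul_of_commute {V : Type*} [AddCommGroup V] [Module ℂ V]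
    {Z E : ZMod N → Module.End ℂ V} (hc : ∀ d e, Commute (Z d) (E e)) (x : V) :
    (List.range N).foldr (fun (d : ℕ) y => Z d (E d y)) x =
      ((List.range N).map fun d : ℕ => Z d).prod
        ((List.finRange N).foldr (fun i y => E (colorEquiv N i) y) x) := by
  have h1 : List.range N = (List.finRange N).map Fin.val := by simp
  have h2 := foldr_mul_of_commute (List.range N) (Z := fun d : ℕ => Z d) (E := fun d : ℕ => E d)
    (fun d e => hc d e) x
  rw [h2]
  congr 1
  rw [h1, List.foldr_map]
  rfl

/-- The zero mode factors collected to the left of the Abelian intertwiners. -/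
theorem productTerm_eq (τ ℓ : ℂ) (lam : YoungDiagram) (μ : ZMod N → YoungDiagram)
    (k : ZMod N → ℤ) (x : Fock N) : productTerm N τ ℓ lam μ k x =
      ((List.range N).map fun d : ℕ => zeroFactor N τ ℓ lam (d : ZMod N) (μ d)).prod
        ((List.finRange N).foldr (fun i y => normalExp
          (abelianExponent N τ ℓ lam (colorEquiv N i) (μ (colorEquiv N i)))
          (k (colorEquiv N i)) y) x) := by
  have h := foldr_range_mul_of_commute (Z := fun d => zeroFactor N τ ℓ lam d (μ d))
    (E := fun d => normalExpLin _ (normalOrderable_abelianExponent τ ℓ lam d (μ d)) (k d))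
    (fun d e => commute_zeroFactor_abelian τ ℓ lam d e _ _ _) x
  simp only [normalExpLin_apply] at h
  exact h

/-- The intertwiner is proportional to the product of the zero mode factors and the Abelian
intertwiners. -/
theorem factorization (hN : 3 ≤ N) {τ : ℂ} (hgen : ∀ r : ℕ, 0 < r → exp τ ^ r ≠ 1) (ℓ : ℂ)
    {u : ℂ} (hu : u ≠ 0) (M : ℤ) {lam : YoungDiagram} {μ : ZMod N → YoungDiagram}
    (hμ : ∀ d, IsQuotient N lam d (μ d)) :
    ∃ s : ℂ, s ≠ 0 ∧ ∀ (n : ℤ) (x : Fock N),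
      {k : ZMod N → ℤ | ∑ d, k d = n ∧ productTerm N τ ℓ lam μ k x ≠ 0}.Finite ∧
      phi N 0 τ ℓ u M lam n x =
        s • ∑ᶠ k : {k : ZMod N → ℤ // ∑ d, k d = n}, productTerm N τ ℓ lam μ k.1 x := by
  obtain ⟨s, hs, hz⟩ := exists_zLam_eq_smul τ ℓ hμ
  set Z := ((List.range N).map fun d : ℕ => zeroFactor N τ ℓ lam (d : ZMod N) (μ d)).prod with hZ
  set X : Fin N → ℤ → Module.End ℂ (Fock N) := fun i =>
    abelianExponent N τ ℓ lam (colorEquiv N i) (μ (colorEquiv N i)) with hXdef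
  have hX : ∀ i, NormalOrderable (X i) := fun i => normalOrderable_abelianExponent τ ℓ lam _ _
  have hc : ∀ i j, i ≠ j → ∀ m k, Commute (X i m) (X j k) := fun i j hij m k =>
    commute_abelianExponent hN τ ℓ lam (fun h => hij ((colorEquiv N).injective h)) _ _ m k
  have hsum : phiExponent N 0 τ ℓ lam = ∑ i, X i := by
    rw [phiExponent_eq_sum hN hgen ℓ hμ, ← Equiv.sum_comp (colorEquiv N)]
  -- functions on colours correspond to functions on `Fin N`
  set e : (ZMod N → ℤ) ≃ (Fin N → ℤ) := (Equiv.arrowCongr (colorEquiv N) (Equiv.refl ℤ)).symm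
    with he
  have hesum : ∀ k : ZMod N → ℤ, ∑ i, e k i = ∑ d, k d := fun k =>
    Equiv.sum_comp (colorEquiv N) k
  set P : (Fin N → ℤ) → Fock N → Fock N := fun k x =>
    (List.finRange N).foldr (fun i y => normalExp (X i) (k i) y) x with hP
  have hprod : ∀ (k : ZMod N → ℤ) (x : Fock N),
      productTerm N τ ℓ lam μ k x = Z (P (e k) x) := fun k x => productTerm_eq τ ℓ lam μ k x
  refine ⟨_, mul_ne_zero (prefactor_ne_zero (N := N) hgen ℓ hu M lam) hs, fun n x => ?_⟩
  have hfin := finite_setOf_foldr_ne_zero hX hc n x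
  constructor
  · refine (hfin.preimage e.injective.injOn).subset ?_
    rintro k ⟨hk, hne⟩
    refine ⟨(hesum k).trans hk, fun h => hne ?_⟩
    rw [hprod]
    exact (congrArg Z h).trans (map_zero Z)
  · rw [phi, hsum, hz, LinearMap.smul_apply, smul_smul]
    refine congrArg _ ?_
    refine Eq.trans ?_ (finsum_subtype_eq_finsum_cond
      (f := fun k : ZMod N → ℤ => productTerm N τ ℓ lam μ k x) fun k => ∑ d, k d = n).symm
    rw [← (finsum_foldr_normalExp hX hc).2 n x]
    have hmap := AddMonoidHom.map_finsum Z.toAddMonoidHom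
      (f := fun k : Fin N → ℤ => if ∑ i, k i = n then P k x else 0) (hfin.subset fun k hk => by
        by_contra hcon
        apply hk
        simp only
        split_ifs with h
        · by_contra h'
          exact hcon ⟨h, h'⟩
        · rfl)
    refine hmap.trans ?_
    rw [← finsum_comp_equiv e]
    refine finsum_congr fun k => ?_
    rw [finsum_eq_if]
    change Z (if _ then _ else _) = _
    rw [apply_ite Z, map_zero, hesum, ← hprod]

end

end Toroidal

theorem mainTheorem6 (N : ℕ) [NeZero N] (hN : 3 ≤ N) (τ ℓ u : ℂ) (hu : u ≠ 0)
    (hgen : ∀ r : ℕ, 0 < r → Complex.exp τ ^ r ≠ 1) (M : ℤ) (lam : YoungDiagram) :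
    -- the modified generators are `N` independent bosons
    (∀ (d f : ZMod N) (r s : ℤ),
      Toroidal.bosonTilde N τ d r * Toroidal.bosonTilde N τ f s
          - Toroidal.bosonTilde N τ f s * Toroidal.bosonTilde N τ d r =
        if d = f ∧ r + s = 0 then
          ((1 - Complex.exp τ ^ (r * (N : ℤ))) * (1 - Complex.exp τ ^ (-r * (N : ℤ))) * (r : ℂ)) •
            (1 : Module.End ℂ (Toroidal.Fock N))
        else 0) ∧
    -- the modified zero modes: `H_{c,0} = H̃_{c,0} - H̃_{c-1,0}` and `∑_d H̃_{d,0} = 0`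
    (∀ (c : ZMod N) (y : ℂ),
      Toroidal.powH τ c y * Toroidal.powHTilde τ (c - 1) y 1 = Toroidal.powHTilde τ c y 1) ∧
    (∀ y : ℂ, ((List.range N).map fun d : ℕ =>
      Toroidal.powHTilde τ (d : ZMod N) y 1).prod = 1) ∧
    -- shifts and quotients
    (∑ d : ZMod N, Toroidal.shift N lam d = 0) ∧
    ∃ μ : ZMod N → YoungDiagram,
      (∀ d, Toroidal.IsQuotient N lam d (μ d)) ∧
      -- the normal ordered exponentials are well defined
      Toroidal.NormalOrderable (Toroidal.phiExponent N 0 τ ℓ lam) ∧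
      (∀ d, Toroidal.NormalOrderable (Toroidal.abelianExponent N τ ℓ lam d (μ d))) ∧
      -- the Abelian intertwiners commute
      (∀ d f : ZMod N, d ≠ f → ∀ m n : ℤ, Commute
        (Toroidal.abelianFactor N τ ℓ lam d (μ d) m)
        (Toroidal.abelianFactor N τ ℓ lam f (μ f) n)) ∧
      -- the factorization: in each degree the product is a finite sum on each vector, and it is
      -- proportional to the intertwiner
      ∃ s : ℂ, s ≠ 0 ∧ ∀ (n : ℤ) (x : Toroidal.Fock N),
        {k : ZMod N → ℤ | ∑ d, k d = n ∧ Toroidal.productTerm N τ ℓ lam μ k x ≠ 0}.Finite ∧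
        Toroidal.phi N 0 τ ℓ u M lam n x =
          s • ∑ᶠ k : {k : ZMod N → ℤ // ∑ d, k d = n},
            Toroidal.productTerm N τ ℓ lam μ k.1 x := by
  have hq := fun d => Toroidal.exists_isQuotient (N := N) lam d
  choose μ hμ using hq
  refine ⟨fun d f r s => Toroidal.bosonTilde_commutator hN τ d f r s,
    Toroidal.powH_mul_powHTilde τ, Toroidal.prod_powHTilde τ, Toroidal.sum_shift N lam, μ, hμ,
    Toroidal.normalOrderable_phiExponent τ ℓ lam,
    fun d => Toroidal.normalOrderable_abelianExponent τ ℓ lam d (μ d), fun d f hdf m n => ?_,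
    Toroidal.factorization hN hgen ℓ hu M hμ⟩
  have h := Toroidal.commute_normalExpLin_normalExpLin
    (Toroidal.normalOrderable_abelianExponent τ ℓ lam d (μ d))
    (Toroidal.normalOrderable_abelianExponent τ ℓ lam f (μ f))
    (fun m n => Toroidal.commute_abelianExponent hN τ ℓ lam hdf (μ d) (μ f) m n) m n
  exact funext fun x => LinearMap.congr_fun h x
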